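/- **Theorem 3.** Let $K\ge 1$ and let $I_1,\dots,I_K$ be $K$ copies of $(-\infty,0)$; the network $\bigcup_i\overline{I_i}$ is the union of the closed half-lines glued at $0$. Let $H_i(x,p)$ ($x\in\overline{I_i}$, $p\in\mathbb R$, $i=1,\dots,K$) be Hamiltonians such that, for every $i$: - for every $R>0$, $H_i$ is Lipschitz continuous on $\overline{I_i}\times(-R,R)$; - $H_i(x,p)\to\infty$ as $|p|\to\infty$, uniformly in $x$; - for every $R>0$ there is $C_R>0$ with $|H_i(x,p)-H_i(y,p)|\le C_R(1+|p|)|x-y|$ if $|p|\le R$; - $M:=\sup\{|H_j(x,0)| : x\in I_j,\ 1\le j\le K\}<\infty$; - $H_i$ is in separated form, $H_i(x,p)=H_i(p)-f_i(x)$. Consider the stationary problem $$u+H_i(x,u_{x_i})=0\ \text{ in } I_i,\qquad \sum_{i=1}^K u_{x_i}=0\ \text{ at } 0. \tag{1}$$ A test function is a continuous function $\varphi$ on the network that is $C^1$ on each closed edge $\overline{I_i}$. A viscosity solution of (1) is a continuous function $u$ on the network such that, for every test function $\varphi$, at every local maximum point $x$ of $u-\varphi$ $$u(x)+H_i(x,\varphi_{x_i}(x))\le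 0\ \text{ if } x\in I_i,\qquad \min\Big\{\sum_i\varphi_{x_i}(0^-),\ u(0)+\min_i H_i(0,\varphi_{x_i}(0^-))\Big\}\le 0\ \text{ if } x=0,$$ and at every local minimum point $x$ of $u-\varphi$ $$u(x)+H_i(x,\varphi_{x_i}(x))\ge 0\ \text{ if } x\in I_i,\qquad \max\Big\{\sum_i\varphi_{x_i}(0^-),\ u(0)+\max_i H_i(0,\varphi_{x_i}(0^-))\Big\}\ge 0\ \text{ if } x=0.$$ Let $G_1,\dots,G_K:\mathbb R\times\mathbb R\to\mathbb R$ be numerical Hamiltonians with a common Lipschitz constant $L_1>0$, that is, $|G_i(p_1,p_2)-G_i(q_1,q_2)|\le L_1(|p_1-q_1|+|p_2-q_2|)$, which are consistent: $G_i(p,p)=\min\{H_i(p),\,M+\sup_{I_i}|f_i|+1\}$ for all $p\in\mathbb R$. For $\Delta x>0$, discretize each edge as $J_i=\{0,1,2,\dots\}$, with $m\in J_i$ standing for the point $-m\Delta x\in\overline{I_i}$, and glue the $J_i$ at $0$. Let $1_i$ be the point $1$ of $J_i$, and for $\varepsilon>0$ put $$D^+U(m)=\frac{U(m-1)-U(m)}{\Delta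 x},\quad D^-U(m)=\frac{U(m)-U(m+1)}{\Delta x},\quad F_i(p_1,p_2)=-\frac{\varepsilon}{\Delta x}(p_1-p_2)+G_i(p_1,p_2).$$ Consider the scheme, for functions $U$ on $\bigcup_iJ_i$, $$U(m)+F_i(D^+U(m),D^-U(m))=f_i(-m\Delta x)\ \text{ if } m\in J_i\setminus\{0\},\qquad U(0)=\frac1K\sum_{i=1}^K U(1_i). \tag{2}$$ Sub-solutions (super-solutions) of (2) satisfy (2) with both equalities replaced by $\le$ ($\ge$). The scheme is monotone if, whenever $V$ is a sub-solution, $\chi$ a function on $\bigcup_iJ_i$, and $V-\chi$ has a global maximum at $m\in J_i$, then $V(m)+F_i(D^+\chi(m),D^-\chi(m))\le f_i(-m\Delta x)$ if $m\ne0$, and $\chi(0)\le\frac1K\sum_i\chi(1_i)$ if $m=0$; and likewise, with the reversed inequalities, for super-solutions and global minima. 1. If $\Delta x>0$ and $\varepsilon\ge 2L_1\Delta x$, then (2) is monotone and has a unique bounded solution $U$. 2. For every $L_2>0$ there is a constant $C>0$, independent of $\Delta x$ and $\varepsilon$, such that, if $\Delta x>0$ and the CFL condition $2L_1\Delta x\le\varepsilon\le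 L_2\Delta x$ holds, $U$ is the bounded solution of (2), $u$ is the bounded viscosity solution of (1), and $u_d$ is the restriction of $u$ to the grid, $u_d(m)=u(-m\Delta x)$ for $m\in J_i$, then $$\sup|U-u_d|\le C\,\Delta x^{1/2}.$$ -/

import Mathlib

open Set

namespace KirchhoffNetwork

/-! ### The network and the stationary Hamilton-Jacobi problem

The network is the union of `K` copies of the half-line `(-∞, 0]` glued at `0`. A function on it is
a family `u : Fin K → ℝ → ℝ`, of which only the values `u i x` with `x ≤ 0` matter, whose members
take the same value at `0`. A neighbourhood of the junction `0` is a union of neighbourhoods of `0`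
in the `K` closed edges, and a neighbourhood of a point `x < 0` of an edge lies in that edge. -/

/-- The members of the family agree at the junction. -/
def Glued {K : ℕ} (u : Fin K → ℝ → ℝ) : Prop :=
  ∀ i j, u i 0 = u j 0

/-- Boundedness of a function on the network. -/
def BoundedOnNetwork {K : ℕ} (u : Fin K → ℝ → ℝ) : Prop :=
  ∃ B : ℝ, ∀ i, ∀ x ≤ (0 : ℝ), |u i x| ≤ B

/-- Test functions: continuous on the network and `C¹` on each closed edge (up to the junction);
the one-sided slopes at the junction are unrelated. -/
def IsTestFunction {K : ℕ} (φ : Fin K → ℝ → ℝ) : Prop :=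
  Glued φ ∧ ∀ i, ContDiffOn ℝ 1 (φ i) (Iic 0)

/-- The derivative along an edge; at `x = 0` it is the left derivative. -/
noncomputable def edgeSlope {K : ℕ} (φ : Fin K → ℝ → ℝ) (i : Fin K) (x : ℝ) : ℝ :=
  derivWithin (φ i) (Iic 0) x

/-- Viscosity sub-solutions of `u + H i (x, u_x) = 0` on the edges, `∑ i, u_{x_i} = 0` at the
junction. The last disjunction is
`min {∑ i, φ_{x_i}(0), u(0) + min_i H i (0, φ_{x_i}(0))} ≤ 0`. -/
structure IsViscositySub {K : ℕ} (H : Fin K → ℝ → ℝ → ℝ) (u : Fin K → ℝ → ℝ) : Prop where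
  glued : Glued u
  usc : ∀ i, UpperSemicontinuousOn (u i) (Iic 0)
  edge : ∀ φ, IsTestFunction φ → ∀ i, ∀ x < (0 : ℝ),
    IsLocalMaxOn (fun y => u i y - φ i y) (Iic 0) x →
    u i x + H i x (edgeSlope φ i x) ≤ 0
  junction : ∀ φ, IsTestFunction φ →
    (∀ i, IsLocalMaxOn (fun y => u i y - φ i y) (Iic 0) 0) →
    (∑ i, edgeSlope φ i 0 ≤ 0) ∨ ∃ i, u i 0 + H i 0 (edgeSlope φ i 0) ≤ 0

/-- Viscosity super-solutions. The last disjunction is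
`max {∑ i, φ_{x_i}(0), u(0) + max_i H i (0, φ_{x_i}(0))} ≥ 0`. -/
structure IsViscositySuper {K : ℕ} (H : Fin K → ℝ → ℝ → ℝ) (u : Fin K → ℝ → ℝ) : Prop where
  glued : Glued u
  lsc : ∀ i, LowerSemicontinuousOn (u i) (Iic 0)
  edge : ∀ φ, IsTestFunction φ → ∀ i, ∀ x < (0 : ℝ),
    IsLocalMinOn (fun y => u i y - φ i y) (Iic 0) x →
    0 ≤ u i x + H i x (edgeSlope φ i x)
  junction : ∀ φ, IsTestFunction φ →
    (∀ i, IsLocalMinOn (fun y => u i y - φ i y) (Iic 0) 0) →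
    (0 ≤ ∑ i, edgeSlope φ i 0) ∨ ∃ i, 0 ≤ u i 0 + H i 0 (edgeSlope φ i 0)

/-- Viscosity solutions: continuous functions that are both sub- and super-solutions. -/
def IsViscositySolution {K : ℕ} (H : Fin K → ℝ → ℝ → ℝ) (u : Fin K → ℝ → ℝ) : Prop :=
  (∀ i, ContinuousOn (u i) (Iic 0)) ∧ IsViscositySub H u ∧ IsViscositySuper H u

/-! ### Assumptions on the Hamiltonians `H i x p`, `x ≤ 0` -/

/-- `H i` is uniformly Lipschitz on `(-∞, 0] × (-R, R)` for every `R > 0`. -/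
def LocallyLipschitzHam {K : ℕ} (H : Fin K → ℝ → ℝ → ℝ) : Prop :=
  ∀ i, ∀ R > (0 : ℝ), ∃ C : ℝ, ∀ x ≤ (0 : ℝ), ∀ y ≤ (0 : ℝ), ∀ p q : ℝ, |p| < R → |q| < R →
    |H i x p - H i y q| ≤ C * (|x - y| + |p - q|)

/-- `H i x p → ∞` as `|p| → ∞`, uniformly in `x`. -/
def CoerciveHam {K : ℕ} (H : Fin K → ℝ → ℝ → ℝ) : Prop :=
  ∀ i, ∀ A : ℝ, ∃ R : ℝ, ∀ x ≤ (0 : ℝ), ∀ p : ℝ, R ≤ |p| → A ≤ H i x p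

/-- `|H i x p - H i y p| ≤ C_R (1 + |p|) |x - y|` for `|p| ≤ R`. -/
def SpaceLipschitzHam {K : ℕ} (H : Fin K → ℝ → ℝ → ℝ) : Prop :=
  ∀ i, ∀ R > (0 : ℝ), ∃ C > (0 : ℝ), ∀ x ≤ (0 : ℝ), ∀ y ≤ (0 : ℝ), ∀ p : ℝ, |p| ≤ R →
    |H i x p - H i y p| ≤ C * (1 + |p|) * |x - y|

/-! ### The finite-difference scheme

The discretized network is the union of `K` copies of `ℕ` glued at `0`; the node `m` of edge `i` is
the point `-m Δx` of that edge. -/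

/-- The members of the family agree at the junction. -/
def GridGlued {K : ℕ} (U : Fin K → ℕ → ℝ) : Prop :=
  ∀ i j, U i 0 = U j 0

/-- Boundedness of a grid function. -/
def GridBounded {K : ℕ} (U : Fin K → ℕ → ℝ) : Prop :=
  ∃ B : ℝ, ∀ i m, |U i m| ≤ B

/-- `D⁺U(m) = (U(m - 1) - U(m)) / Δx`, used for `m ≥ 1` only. -/
noncomputable def Dplus (Δx : ℝ) (V : ℕ → ℝ) (m : ℕ) : ℝ :=
  (V (m - 1) - V m) / Δx

/-- `D⁻U(m) = (U(m) - U(m + 1)) / Δx`. -/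
noncomputable def Dminus (Δx : ℝ) (V : ℕ → ℝ) (m : ℕ) : ℝ :=
  (V m - V (m + 1)) / Δx

/-- `F(p₁, p₂) = -(ε / Δx) (p₁ - p₂) + G(p₁, p₂)`. -/
noncomputable def schemeOp (Δx ε : ℝ) (G : ℝ → ℝ → ℝ) (p₁ p₂ : ℝ) : ℝ :=
  -(ε / Δx) * (p₁ - p₂) + G p₁ p₂

/-- Solutions of the scheme. -/
structure IsSchemeSolution {K : ℕ} (Δx ε : ℝ) (G : Fin K → ℝ → ℝ → ℝ) (f : Fin K → ℝ → ℝ)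
    (U : Fin K → ℕ → ℝ) : Prop where
  glued : GridGlued U
  edge : ∀ i (m : ℕ), m ≠ 0 →
    U i m + schemeOp Δx ε (G i) (Dplus Δx (U i) m) (Dminus Δx (U i) m) = f i (-(m * Δx))
  junction : ∀ i, U i 0 = 1 / (K : ℝ) * ∑ j, U j 1

/-- Sub-solutions of the scheme. -/
structure IsSchemeSub {K : ℕ} (Δx ε : ℝ) (G : Fin K → ℝ → ℝ → ℝ) (f : Fin K → ℝ → ℝ)
    (V : Fin K → ℕ → ℝ) : Prop where
  glued : GridGlued V
  edge : ∀ i (m : ℕ), m ≠ 0 →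
    V i m + schemeOp Δx ε (G i) (Dplus Δx (V i) m) (Dminus Δx (V i) m) ≤ f i (-(m * Δx))
  junction : ∀ i, V i 0 ≤ 1 / (K : ℝ) * ∑ j, V j 1

/-- Super-solutions of the scheme. -/
structure IsSchemeSuper {K : ℕ} (Δx ε : ℝ) (G : Fin K → ℝ → ℝ → ℝ) (f : Fin K → ℝ → ℝ)
    (W : Fin K → ℕ → ℝ) : Prop where
  glued : GridGlued W
  edge : ∀ i (m : ℕ), m ≠ 0 →
    f i (-(m * Δx)) ≤ W i m + schemeOp Δx ε (G i) (Dplus Δx (W i) m) (Dminus Δx (W i) m)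
  junction : ∀ i, 1 / (K : ℝ) * ∑ j, W j 1 ≤ W i 0

/-- Monotonicity: a grid function that touches a sub-solution from above (a super-solution from
below), up to a constant, satisfies the corresponding inequality at the contact point. -/
structure IsMonotoneScheme {K : ℕ} (Δx ε : ℝ) (G : Fin K → ℝ → ℝ → ℝ) (f : Fin K → ℝ → ℝ) :
    Prop where
  sub : ∀ V χ : Fin K → ℕ → ℝ, IsSchemeSub Δx ε G f V → GridGlued χ → ∀ i (m : ℕ),
    (∀ j k, V j k - χ j k ≤ V i m - χ i m) →
    (m ≠ 0 → V i m + schemeOp Δx ε (G i) (Dplus Δx (χ i) m) (Dminus Δx (χ i) m)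
      ≤ f i (-(m * Δx))) ∧
    (m = 0 → χ i 0 ≤ 1 / (K : ℝ) * ∑ j, χ j 1)
  super : ∀ W χ : Fin K → ℕ → ℝ, IsSchemeSuper Δx ε G f W → GridGlued χ → ∀ i (m : ℕ),
    (∀ j k, W i m - χ i m ≤ W j k - χ j k) →
    (m ≠ 0 → f i (-(m * Δx)) ≤
      W i m + schemeOp Δx ε (G i) (Dplus Δx (χ i) m) (Dminus Δx (χ i) m)) ∧
    (m = 0 → 1 / (K : ℝ) * ∑ j, χ j 1 ≤ χ i 0)

end KirchhoffNetwork

namespace KirchhoffNetwork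

open Filter Topology

/-! ### Monotonicity and well-posedness of the scheme -/

theorem schemeOp_le_schemeOp {Δx ε L₁ : ℝ} {G : ℝ → ℝ → ℝ} (hΔ : 0 < Δx) (hε : L₁ * Δx ≤ ε)
    (hG : ∀ p₁ p₂ q₁ q₂ : ℝ, |G p₁ p₂ - G q₁ q₂| ≤ L₁ * (|p₁ - q₁| + |p₂ - q₂|))
    {p₁ p₂ q₁ q₂ : ℝ} (h₁ : q₁ ≤ p₁) (h₂ : p₂ ≤ q₂) :
    schemeOp Δx ε G p₁ p₂ ≤ schemeOp Δx ε G q₁ q₂ := by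
  have hκ : L₁ ≤ ε / Δx := by rwa [le_div_iff₀ hΔ]
  have h := (abs_le.mp (hG p₁ p₂ q₁ q₂)).2
  rw [abs_of_nonneg (sub_nonneg.mpr h₁), abs_of_nonpos (sub_nonpos.mpr h₂)] at h
  unfold schemeOp
  nlinarith [mul_nonneg (sub_nonneg.mpr hκ)
    (add_nonneg (sub_nonneg.mpr h₁) (sub_nonneg.mpr h₂))]

theorem isMonotoneScheme {K : ℕ} {Δx ε L₁ : ℝ} {G : Fin K → ℝ → ℝ → ℝ}
    {f : Fin K → ℝ → ℝ} (hΔ : 0 < Δx) (hε : L₁ * Δx ≤ ε)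
    (hG : ∀ i, ∀ p₁ p₂ q₁ q₂ : ℝ, |G i p₁ p₂ - G i q₁ q₂| ≤ L₁ * (|p₁ - q₁| + |p₂ - q₂|)) :
    IsMonotoneScheme Δx ε G f where
  sub V χ hV hχ i m hmax := by
    refine ⟨fun hm => ?_, fun hm => ?_⟩
    · refine le_trans ?_ (hV.edge i m hm)
      gcongr
      apply schemeOp_le_schemeOp hΔ hε (hG i)
      · unfold Dplus
        have := hmax i (m - 1)
        gcongr ?_ / _
        linarith
      · unfold Dminus
        have := hmax i (m + 1)
        gcongr ?_ / _
        linarith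
    · subst hm
      have h1 := hV.junction i
      have hK : (0 : ℝ) < K := by exact_mod_cast i.pos
      have h2 : ∑ j, V j 1 ≤ ∑ j, (χ j 1 + (V i 0 - χ i 0)) :=
        Finset.sum_le_sum fun j _ => by linarith [hmax j 1]
      rw [Finset.sum_add_distrib, Finset.sum_const, Finset.card_univ, Fintype.card_fin,
        nsmul_eq_mul] at h2
      have h3 := mul_le_mul_of_nonneg_left h2 (by positivity : 0 ≤ 1 / (K : ℝ))
      have h4 : 1 / (K : ℝ) * (∑ j, χ j 1 + K * (V i 0 - χ i 0))
          = 1 / (K : ℝ) * ∑ j, χ j 1 + (V i 0 - χ i 0) := by field_simp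
      linarith
  super W χ hW hχ i m hmin := by
    refine ⟨fun hm => ?_, fun hm => ?_⟩
    · refine le_trans (hW.edge i m hm) ?_
      gcongr
      apply schemeOp_le_schemeOp hΔ hε (hG i)
      · unfold Dplus
        have := hmin i (m - 1)
        gcongr ?_ / _
        linarith
      · unfold Dminus
        have := hmin i (m + 1)
        gcongr ?_ / _
        linarith
    · subst hm
      have h1 := hW.junction i
      have hK : (0 : ℝ) < K := by exact_mod_cast i.pos
      have h2 : ∑ j, (χ j 1 + (W i 0 - χ i 0)) ≤ ∑ j, W j 1 :=
        Finset.sum_le_sum fun j _ => by linarith [hmin j 1]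
      rw [Finset.sum_add_distrib, Finset.sum_const, Finset.card_univ, Fintype.card_fin,
        nsmul_eq_mul] at h2
      have h3 := mul_le_mul_of_nonneg_left h2 (by positivity : 0 ≤ 1 / (K : ℝ))
      have h4 : 1 / (K : ℝ) * (∑ j, χ j 1 + K * (W i 0 - χ i 0))
          = 1 / (K : ℝ) * ∑ j, χ j 1 + (W i 0 - χ i 0) := by field_simp
      linarith

/-- One damped fixed-point step at a node with value `b` and neighbours `a`, `c`. -/
noncomputable def relaxStep (Δx ε τ : ℝ) (G : ℝ → ℝ → ℝ) (y a b c : ℝ) : ℝ :=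
  b - τ * (b + schemeOp Δx ε G ((a - b) / Δx) ((b - c) / Δx) - y)

/-- A damping parameter for which `relaxStep` is monotone. -/
noncomputable def damping (Δx ε L₁ : ℝ) : ℝ :=
  1 / (1 + 2 * (ε / Δx + L₁) / Δx)

/-! ### The damped relaxation step. -/

section Relax

variable {Δx ε L₁ : ℝ} {G : ℝ → ℝ → ℝ}

theorem damping_pos (hΔ : 0 < Δx) (hL : 0 ≤ L₁) (hε : L₁ * Δx ≤ ε) : 0 < damping Δx ε L₁ := by
  have : 0 ≤ ε := le_trans (by positivity) hε
  unfold damping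
  positivity

theorem damping_le_one (hΔ : 0 < Δx) (hL : 0 ≤ L₁) (hε : L₁ * Δx ≤ ε) :
    damping Δx ε L₁ ≤ 1 := by
  have : 0 ≤ ε := le_trans (by positivity) hε
  unfold damping
  rw [div_le_one (by positivity)]
  have : 0 ≤ 2 * (ε / Δx + L₁) / Δx := by positivity
  linarith

/-- Monotonicity in the neighbours is that of the scheme. In the central value, the residual grows
at rate at most `1 + 2 (ε / Δx + L₁) / Δx`, the inverse of the damping parameter. -/
theorem relaxStep_mono (hΔ : 0 < Δx) (hL : 0 ≤ L₁) (hε : L₁ * Δx ≤ ε)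
    (hG : ∀ p₁ p₂ q₁ q₂ : ℝ, |G p₁ p₂ - G q₁ q₂| ≤ L₁ * (|p₁ - q₁| + |p₂ - q₂|))
    {y a b c a' b' c' : ℝ} (ha : a ≤ a') (hb : b ≤ b') (hc : c ≤ c') :
    relaxStep Δx ε (damping Δx ε L₁) G y a b c ≤
      relaxStep Δx ε (damping Δx ε L₁) G y a' b' c' := by
  have hε0 : 0 ≤ ε := le_trans (by positivity) hε
  have hτ := damping_pos hΔ hL hε
  have hτ' : damping Δx ε L₁ * (1 + 2 * (ε / Δx + L₁) / Δx) = 1 := by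
    unfold damping
    have : 0 < 1 + 2 * (ε / Δx + L₁) / Δx := by positivity
    field_simp
  set τ := damping Δx ε L₁
  have h1 : schemeOp Δx ε G ((a' - b') / Δx) ((b' - c') / Δx) ≤
      schemeOp Δx ε G ((a - b') / Δx) ((b' - c) / Δx) := by
    apply schemeOp_le_schemeOp hΔ hε hG <;> gcongr
  have h2 : schemeOp Δx ε G ((a - b') / Δx) ((b' - c) / Δx) ≤
      schemeOp Δx ε G ((a - b) / Δx) ((b - c) / Δx) + 2 * (ε / Δx + L₁) / Δx * (b' - b) := by
    have h := (abs_le.mp (hG ((a - b') / Δx) ((b' - c) / Δx) ((a - b) / Δx) ((b - c) / Δx))).2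
    have e1 : (a - b') / Δx - (a - b) / Δx = -((b' - b) / Δx) := by ring
    have e2 : (b' - c) / Δx - (b - c) / Δx = (b' - b) / Δx := by ring
    have h0 : 0 ≤ (b' - b) / Δx := div_nonneg (by linarith) hΔ.le
    rw [e1, e2, abs_neg, abs_of_nonneg h0] at h
    have e3 : 2 * (ε / Δx + L₁) / Δx * (b' - b)
        = 2 * (ε / Δx) * ((b' - b) / Δx) + 2 * L₁ * ((b' - b) / Δx) := by ring
    have e4 : (a - b') / Δx - (b' - c) / Δx
        = (a - b) / Δx - (b - c) / Δx - 2 * ((b' - b) / Δx) := by ring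
    unfold schemeOp
    rw [e3, e4]
    linarith
  unfold relaxStep
  have h3 := mul_le_mul_of_nonneg_left (h1.trans h2) hτ.le
  have h4 : τ * (2 * (ε / Δx + L₁) / Δx * (b' - b)) = (1 - τ) * (b' - b) := by
    linear_combination (b' - b) * hτ'
  nlinarith

/-- A constant leaves the slopes unchanged and is seen only by the zeroth-order term; this is the
source of the contraction factor `1 - τ`. -/
theorem relaxStep_add (τ y a b c D : ℝ) :
    relaxStep Δx ε τ G y (a + D) (b + D) (c + D) = relaxStep Δx ε τ G y a b c + (1 - τ) * D := by
  unfold relaxStep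
  rw [add_sub_add_right_eq_sub, add_sub_add_right_eq_sub]
  ring

theorem relaxStep_le_add (hΔ : 0 < Δx) (hL : 0 ≤ L₁) (hε : L₁ * Δx ≤ ε)
    (hG : ∀ p₁ p₂ q₁ q₂ : ℝ, |G p₁ p₂ - G q₁ q₂| ≤ L₁ * (|p₁ - q₁| + |p₂ - q₂|))
    {y a b c a' b' c' D : ℝ} (ha : a ≤ a' + D) (hb : b ≤ b' + D) (hc : c ≤ c' + D) :
    relaxStep Δx ε (damping Δx ε L₁) G y a b c ≤
      relaxStep Δx ε (damping Δx ε L₁) G y a' b' c' + (1 - damping Δx ε L₁) * D := by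
  rw [← relaxStep_add]
  exact relaxStep_mono hΔ hL hε hG ha hb hc

end Relax

theorem average_le_average_add {K : ℕ} (hK : 0 < K) {a b : Fin K → ℝ} {D : ℝ}
    (h : ∀ i, a i ≤ b i + D) : 1 / (K : ℝ) * ∑ i, a i ≤ 1 / (K : ℝ) * ∑ i, b i + D := by
  have hK' : (0 : ℝ) < K := by exact_mod_cast hK
  have h2 : ∑ j, a j ≤ ∑ j, (b j + D) := Finset.sum_le_sum fun j _ => h j
  rw [Finset.sum_add_distrib, Finset.sum_const, Finset.card_univ, Fintype.card_fin,
    nsmul_eq_mul] at h2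
  have h3 := mul_le_mul_of_nonneg_left h2 (by positivity : 0 ≤ 1 / (K : ℝ))
  have h4 : 1 / (K : ℝ) * (∑ j, b j + K * D) = 1 / (K : ℝ) * ∑ j, b j + D := by field_simp
  linarith

/-! ### Comparison and existence for the scheme. -/

section Scheme

variable {K : ℕ} {Δx ε L₁ : ℝ} {G : Fin K → ℝ → ℝ → ℝ} {f : Fin K → ℝ → ℝ}

/-- A sub-solution lies below its relaxation and a super-solution above, so each relaxation shrinks
the bound on `V - W` by `1 - τ`. No maximum on the infinite grid has to be attained. -/
theorem scheme_comparison (hΔ : 0 < Δx) (hL : 0 ≤ L₁) (hε : L₁ * Δx ≤ ε)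
    (hG : ∀ i, ∀ p₁ p₂ q₁ q₂ : ℝ, |G i p₁ p₂ - G i q₁ q₂| ≤ L₁ * (|p₁ - q₁| + |p₂ - q₂|))
    {V W : Fin K → ℕ → ℝ} (hV : IsSchemeSub Δx ε G f V) (hW : IsSchemeSuper Δx ε G f W)
    (hVb : GridBounded V) (hWb : GridBounded W) (i : Fin K) (m : ℕ) : V i m ≤ W i m := by
  obtain ⟨B, hB⟩ := hVb
  obtain ⟨B', hB'⟩ := hWb
  have hτ0 := damping_pos hΔ hL hε
  have hτ1 := damping_le_one hΔ hL hε
  set τ := damping Δx ε L₁ with hτ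
  have key : ∀ n : ℕ, ∀ i m, V i m ≤ W i m + (1 - τ) ^ n * (B + B') := by
    intro n
    induction n with
    | zero =>
      intro i m
      have h1 := (abs_le.mp (hB i m)).2
      have h2 := (abs_le.mp (hB' i m)).1
      linarith
    | succ n ih =>
      -- The junction has no contraction of its own; it inherits the improved bound as an average of
      -- the nodes `1`.
      have hpos : ∀ i m, m ≠ 0 → V i m ≤ W i m + (1 - τ) ^ (n + 1) * (B + B') := by
        intro i m hm
        have h1 : V i m ≤ relaxStep Δx ε τ (G i) (f i (-(m * Δx)))
            (V i (m - 1)) (V i m) (V i (m + 1)) := by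
          have := hV.edge i m hm
          unfold Dplus Dminus at this
          unfold relaxStep
          nlinarith
        have h2 : relaxStep Δx ε τ (G i) (f i (-(m * Δx)))
            (W i (m - 1)) (W i m) (W i (m + 1)) ≤ W i m := by
          have := hW.edge i m hm
          unfold Dplus Dminus at this
          unfold relaxStep
          nlinarith
        have h3 := relaxStep_le_add (y := f i (-(m * Δx))) hΔ hL hε (hG i) (ih i (m - 1)) (ih i m)
          (ih i (m + 1))
        rw [← hτ] at h3
        rw [pow_succ']
        linarith
      intro i m
      rcases Nat.eq_zero_or_pos m with rfl | hm
      · have := average_le_average_add i.pos fun j => hpos j 1 one_ne_zero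
        linarith [hV.junction i, hW.junction i]
      · exact hpos i m hm.ne'
  have hlim : Filter.Tendsto (fun n : ℕ => W i m + (1 - τ) ^ n * (B + B')) Filter.atTop
      (nhds (W i m + 0 * (B + B'))) :=
    ((tendsto_pow_atTop_nhds_zero_of_lt_one (by linarith) (by linarith)).mul_const _).const_add _
  have := ge_of_tendsto' hlim fun n => key n i m
  linarith

theorem IsSchemeSolution.isSchemeSub {U : Fin K → ℕ → ℝ} (hU : IsSchemeSolution Δx ε G f U) :
    IsSchemeSub Δx ε G f U :=
  ⟨hU.glued, fun i m hm => (hU.edge i m hm).le, fun i => (hU.junction i).le⟩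

theorem IsSchemeSolution.isSchemeSuper {U : Fin K → ℕ → ℝ} (hU : IsSchemeSolution Δx ε G f U) :
    IsSchemeSuper Δx ε G f U :=
  ⟨hU.glued, fun i m hm => (hU.edge i m hm).ge, fun i => (hU.junction i).ge⟩

/-- The grid function with prescribed values at the nodes `m ≥ 1` and their average at the
junction. -/
noncomputable def gridExtend (V : Fin K × ℕ → ℝ) (i : Fin K) : ℕ → ℝ
  | 0 => 1 / (K : ℝ) * ∑ j, V (j, 0)
  | n + 1 => V (i, n)

theorem gridExtend_le_add (hK : 0 < K) {V W : Fin K × ℕ → ℝ} {D : ℝ}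
    (h : ∀ z, V z ≤ W z + D) (i : Fin K) (m : ℕ) :
    gridExtend V i m ≤ gridExtend W i m + D := by
  cases m with
  | zero => exact average_le_average_add hK fun j => h (j, 0)
  | succ n => exact h (i, n)

theorem exists_scheme_solution (hK : 0 < K) (hΔ : 0 < Δx) (hL : 0 ≤ L₁) (hε : L₁ * Δx ≤ ε)
    (hG : ∀ i, ∀ p₁ p₂ q₁ q₂ : ℝ, |G i p₁ p₂ - G i q₁ q₂| ≤ L₁ * (|p₁ - q₁| + |p₂ - q₂|))
    (hf : ∃ B, ∀ i, ∀ x < (0 : ℝ), |f i x| ≤ B) :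
    ∃ U : Fin K → ℕ → ℝ, IsSchemeSolution Δx ε G f U ∧ GridBounded U := by
  obtain ⟨B, hB⟩ := hf
  have hτ0 := damping_pos hΔ hL hε
  have hτ1 := damping_le_one hΔ hL hε
  set τ := damping Δx ε L₁ with hτ
  -- The unknowns are the values at the nodes `m ≥ 1`: the index `(i, n)` stands for node `n + 1`,
  -- and the junction value is eliminated as an average.
  let T : (Fin K × ℕ → ℝ) → Fin K × ℕ → ℝ := fun V z =>
    relaxStep Δx ε τ (G z.1) (f z.1 (-((z.2 + 1 : ℕ) * Δx)))
      (gridExtend V z.1 z.2) (gridExtend V z.1 (z.2 + 1)) (gridExtend V z.1 (z.2 + 2))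
  have hT : ∀ V W : Fin K × ℕ → ℝ, ∀ D, (∀ z, V z ≤ W z + D) →
      ∀ z, T V z ≤ T W z + (1 - τ) * D := fun V W D h z =>
    relaxStep_le_add hΔ hL hε (hG z.1) (gridExtend_le_add hK h _ _) (gridExtend_le_add hK h _ _)
      (gridExtend_le_add hK h _ _)
  have hT' : ∀ V W : Fin K × ℕ → ℝ, ∀ D, (∀ z, |V z - W z| ≤ D) →
      ∀ z, |T V z - T W z| ≤ (1 - τ) * D := by
    intro V W D h z
    have h1 := hT V W D (fun z => by linarith [(abs_le.mp (h z)).2]) z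
    have h2 := hT W V D (fun z => by linarith [(abs_le.mp (h z)).1]) z
    rw [abs_le]
    constructor <;> linarith
  have hT0 : ∀ z, |T 0 z| ≤ τ * (∑ i, |G i 0 0| + B) := by
    intro z
    have e : ∀ m, gridExtend (0 : Fin K × ℕ → ℝ) z.1 m = 0 := by
      intro m
      cases m <;> simp [gridExtend]
    have hx : (-(((z.2 + 1 : ℕ) : ℝ) * Δx)) < 0 := by
      have : (0 : ℝ) < ((z.2 + 1 : ℕ) : ℝ) := by exact_mod_cast Nat.succ_pos _
      have := mul_pos this hΔ
      linarith
    have h1 := hB z.1 _ hx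
    have h2 : |G z.1 0 0| ≤ ∑ i, |G i 0 0| :=
      Finset.single_le_sum (f := fun i => |G i 0 0|) (fun i _ => abs_nonneg _) (Finset.mem_univ z.1)
    simp only [T, e, relaxStep, schemeOp, sub_self, zero_div, mul_zero, zero_add, zero_sub, abs_neg,
      abs_mul, abs_of_pos hτ0]
    gcongr
    exact (abs_sub _ _).trans (by linarith)
  let Φ : BoundedContinuousFunction (Fin K × ℕ) ℝ → BoundedContinuousFunction (Fin K × ℕ) ℝ :=
    fun V => BoundedContinuousFunction.ofNormedAddCommGroupDiscrete (T V)
      ((1 - τ) * ‖V‖ + τ * (∑ i, |G i 0 0| + B)) fun z => by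
        have h1 := hT' V 0 ‖V‖ (fun z => by simpa using V.norm_coe_le_norm z) z
        have h2 := hT0 z
        rw [Real.norm_eq_abs]
        calc |T V z| = |(T V z - T 0 z) + T 0 z| := by ring_nf
          _ ≤ _ := (abs_add_le _ _).trans (add_le_add h1 h2)
  have hc : ((1 - τ).toNNReal : ℝ) = 1 - τ := Real.coe_toNNReal _ (by linarith)
  have hΦ : ContractingWith (1 - τ).toNNReal Φ := by
    refine ⟨?_, LipschitzWith.of_dist_le_mul fun V W => ?_⟩
    · rw [← NNReal.coe_lt_coe, hc, NNReal.coe_one]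
      linarith
    · rw [BoundedContinuousFunction.dist_le (mul_nonneg (NNReal.coe_nonneg _) dist_nonneg), hc]
      intro z
      rw [Real.dist_eq]
      exact hT' V W _ (fun z => by
        rw [← Real.dist_eq]
        exact BoundedContinuousFunction.dist_coe_le_dist z) z
  obtain ⟨V, hV⟩ : ∃ V, Φ V = V := ⟨hΦ.fixedPoint Φ, hΦ.fixedPoint_isFixedPt⟩
  have hfix : ∀ z, T V z = V z := fun z => by
    conv_rhs => rw [← hV]
    rfl
  refine ⟨gridExtend V, ⟨fun i j => rfl, ?_, fun i => rfl⟩, ‖V‖, fun i m => ?_⟩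
  · intro i m hm
    obtain ⟨n, rfl⟩ := Nat.exists_eq_succ_of_ne_zero hm
    have h := hfix (i, n)
    have h1 : τ * (gridExtend V i (n + 1) + schemeOp Δx ε (G i)
        (Dplus Δx (gridExtend V i) (n + 1)) (Dminus Δx (gridExtend V i) (n + 1))
        - f i (-((n + 1 : ℕ) * Δx))) = 0 := by
      have e : V (i, n) = gridExtend V i (n + 1) := rfl
      simp only [T, relaxStep] at h
      rw [e] at h
      unfold Dplus Dminus
      rw [Nat.add_sub_cancel]
      linarith
    have h2 := (mul_eq_zero.mp h1).resolve_left hτ0.ne'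
    simp only [Nat.succ_eq_add_one]
    linarith
  · have h1 : ∀ z, |V z| ≤ ‖V‖ := fun z => V.norm_coe_le_norm z
    have e : ∀ m, gridExtend (0 : Fin K × ℕ → ℝ) i m = 0 := by
      intro m
      cases m <;> simp [gridExtend]
    have h2 := gridExtend_le_add hK (V := V) (W := 0) (D := ‖V‖)
      (fun z => by simpa using (abs_le.mp (h1 z)).2) i m
    have h3 := gridExtend_le_add hK (V := 0) (W := V) (D := ‖V‖)
      (fun z => by
        have := (abs_le.mp (h1 z)).1
        simp only [Pi.zero_apply]
        linarith) i m
    rw [e] at h2 h3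
    rw [abs_le]
    constructor <;> linarith

end Scheme

/-! ### Viscosity super-solutions in the coordinate `t = -x ≥ 0`

Slopes keep the orientation of `x`, so a function of slope `p` decreases at rate `p` in `t`. -/

/-- Super-solutions of `v + h (v_x) = g` on an open edge, tested with quadratic polynomials. -/
def EdgeSuper (h g v : ℝ → ℝ) : Prop :=
  ∀ t > 0, ∀ p k : ℝ, (∀ᶠ τ in 𝓝 t, v t - p * (τ - t) - k * (τ - t) ^ 2 ≤ v τ) → g t ≤ v t + h p

/-- The Kirchhoff condition for super-solutions, tested with linear functions. -/
def JunctionSuper {K : ℕ} (h g v : Fin K → ℝ → ℝ) : Prop :=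
  ∀ s : Fin K → ℝ, (∀ i, ∀ᶠ t in 𝓝[≥] 0, v i 0 - s i * t ≤ v i t) →
    0 ≤ ∑ i, s i ∨ ∃ i, g i 0 ≤ v i 0 + h i (s i)

theorem exists_interior_min {w : ℝ → ℝ} {a b c : ℝ} (hw : ContinuousOn w (Icc a b))
    (hc : c ∈ Ioo a b) (ha : w c < w a) (hb : w c < w b) :
    ∃ t ∈ Ioo a b, ∀ᶠ τ in 𝓝 t, w t ≤ w τ := by
  obtain ⟨t, ht, hmin⟩ := isCompact_Icc.exists_isMinOn ⟨c, Ioo_subset_Icc_self hc⟩ hw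
  have htc : w t ≤ w c := hmin (Ioo_subset_Icc_self hc)
  have h1 : t ≠ a := fun h => by rw [h] at htc; linarith
  have h2 : t ≠ b := fun h => by rw [h] at htc; linarith
  have ht' : t ∈ Ioo a b := ⟨lt_of_le_of_ne ht.1 h1.symm, lt_of_le_of_ne ht.2 h2⟩
  refine ⟨t, ht', ?_⟩
  filter_upwards [Icc_mem_nhds ht'.1 ht'.2] with τ hτ using hmin hτ

/-- Otherwise `w σ + R σ` drops from `s` to `t`. Adding a barrier `η / (t - σ)`, which excludes a
minimum at the right end, creates an interior minimum, where the contact slope `R + η / (t - x) ^ 2`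
exceeds `R`. -/
theorem le_of_contact_slope_le {w : ℝ → ℝ} {R s t : ℝ} (hst : s < t)
    (hw : ContinuousOn w (Icc s t))
    (hcon : ∀ τ ∈ Ioo s t, ∀ p k : ℝ,
      (∀ᶠ σ in 𝓝 τ, w τ - p * (σ - τ) - k * (σ - τ) ^ 2 ≤ w σ) → p ≤ R) :
    w s - R * (t - s) ≤ w t := by
  by_contra! hlt
  set W : ℝ → ℝ := fun σ => w σ + R * σ with hW
  have hWc : ContinuousOn W (Icc s t) := hw.add (by fun_prop)
  set D := W s - W t with hD
  have hD0 : 0 < D := by simp only [hD, hW]; nlinarith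
  have hWt : Tendsto W (𝓝[<] t) (𝓝 (W t)) :=
    ((hWc t (right_mem_Icc.mpr hst.le)).mono_of_mem_nhdsWithin (Icc_mem_nhdsLT hst))
  have e1 : ∀ᶠ c in 𝓝[<] t, W c < W t + D / 2 := hWt.eventually_lt_const (by linarith)
  have e2 : ∀ᶠ c in 𝓝[<] t, W t - D < W c := hWt.eventually_const_lt (by linarith)
  -- The point `c` nearly realizes the drop and the barrier costs only `D / 4` there; at `b`, chosen
  -- below, it costs at least `2 D`. Hence the minimum over `[s, b]` is interior.
  obtain ⟨c, hc1, hc⟩ := (e1.and (Ioo_mem_nhdsLT hst)).exists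
  set η := (t - c) * D / 4 with hη
  have htc : 0 < t - c := sub_pos.mpr hc.2
  have hη0 : 0 < η := by positivity
  have hlow : max c (t - η / (2 * D)) < t :=
    max_lt hc.2 (by have : 0 < η / (2 * D) := by positivity
                    linarith)
  obtain ⟨b, hb1, hb⟩ := (e2.and (Ioo_mem_nhdsLT hlow)).exists
  have hbt : 0 < t - b := sub_pos.mpr hb.2
  have hcb : c < b := (le_max_left _ _).trans_lt hb.1
  have hbη : 2 * D ≤ η / (t - b) := by
    rw [le_div_iff₀ hbt]
    have h1 : t - b ≤ η / (2 * D) := by linarith [(le_max_right c (t - η / (2 * D))).trans_lt hb.1]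
    rw [le_div_iff₀ (by positivity)] at h1
    linarith
  have hcη : η / (t - c) = D / 4 := by rw [hη]; field_simp
  have hsη : 0 < η / (t - s) := div_pos hη0 (by linarith)
  obtain ⟨x, hx, hmin⟩ := exists_interior_min (w := fun σ => W σ + η / (t - σ)) (a := s) (b := b)
    (c := c)
    (by
      refine (hWc.mono (Icc_subset_Icc_right hb.2.le)).add ?_
      refine continuousOn_const.div (by fun_prop) fun σ hσ => ?_
      have := hσ.2
      linarith)
    ⟨hc.1, hcb⟩ (by linarith) (by linarith)
  have hxt : x < t := hx.2.trans hb.2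
  set e := t - x with he
  have he0 : 0 < e := sub_pos.mpr hxt
  have hcontact := hcon x ⟨hx.1, hxt⟩ (R + η / e ^ 2) (2 * η / e ^ 3) (by
    filter_upwards [hmin, Iio_mem_nhds (by linarith : x < x + e / 2)] with σ h1 h2
    have h2' : e / 2 < e - (σ - x) := by
      have := mem_Iio.mp h2
      linarith
    have h3 : 0 < e - (σ - x) := by linarith
    have h4 : t - σ = e - (σ - x) := by rw [he]; ring
    rw [h4] at h1
    -- Second-order expansion of the barrier; `σ < x + e / 2` keeps the remainder below a fixed
    -- quadratic term.
    have h5 : η / (e - (σ - x)) ≤ η / e + η / e ^ 2 * (σ - x) + 2 * η / e ^ 3 * (σ - x) ^ 2 := by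
      have a1 : η / (e - (σ - x)) = η / e + η / e ^ 2 * (σ - x)
          + η * (σ - x) ^ 2 / (e ^ 2 * (e - (σ - x))) := by
        field_simp
        ring
      have a2 : η * (σ - x) ^ 2 / (e ^ 2 * (e - (σ - x))) ≤
          η * (σ - x) ^ 2 / (e ^ 2 * (e / 2)) := by gcongr
      have a3 : η * (σ - x) ^ 2 / (e ^ 2 * (e / 2)) = 2 * η / e ^ 3 * (σ - x) ^ 2 := by
        field_simp
      linarith
    simp only [hW] at h1
    linarith)
  have : 0 < η / e ^ 2 := by positivity
  linarith

/-- Contact from below alone suffices: reflecting the interval changes the sign of contact slopes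
and gives the opposite one-sided bound. -/
theorem lipschitz_of_contact_slope_le {w : ℝ → ℝ} {R : ℝ} (hw : ContinuousOn w (Ici 0))
    (hcon : ∀ τ > 0, ∀ p k : ℝ,
      (∀ᶠ σ in 𝓝 τ, w τ - p * (σ - τ) - k * (σ - τ) ^ 2 ≤ w σ) → |p| ≤ R)
    {s t : ℝ} (hs : 0 ≤ s) (ht : 0 ≤ t) : |w s - w t| ≤ R * |s - t| := by
  wlog hst : s < t generalizing s t
  · rcases (not_lt.mp hst).eq_or_lt with h | h
    · simp [h]
    · rw [abs_sub_comm, abs_sub_comm s t]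
      exact this ht hs h
  have hsub : Icc s t ⊆ Ici 0 := fun x hx => hs.trans hx.1
  have h1 := le_of_contact_slope_le (R := R) hst (hw.mono hsub) fun τ hτ p k h =>
    (le_abs_self p).trans (hcon τ (hs.trans_lt hτ.1) p k h)
  have h2 := le_of_contact_slope_le (w := fun σ => w (s + t - σ)) (R := R) hst
    (by
      refine (hw.mono hsub).comp (by fun_prop) fun σ hσ => ⟨?_, ?_⟩
      · linarith [hσ.2]
      · linarith [hσ.1])
    (fun τ hτ p k h => by
      refine (neg_le_abs (-p)).trans' (by simp) |>.trans (hcon (s + t - τ) ?_ (-p) k ?_)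
      · linarith [hτ.2]
      · have : Tendsto (fun σ => s + t - σ) (𝓝 (s + t - τ)) (𝓝 τ) := by
          have : ContinuousAt (fun σ : ℝ => s + t - σ) (s + t - τ) := by fun_prop
          simpa [ContinuousAt] using this
        filter_upwards [this.eventually h] with σ hσ
        have e : s + t - (s + t - σ) = σ := by ring
        rw [e] at hσ
        nlinarith)
  have e1 : s + t - s = t := by ring
  have e2 : s + t - t = s := by ring
  simp only [e1, e2] at h2
  rw [abs_of_neg (by linarith : s - t < 0), abs_le]
  constructor <;> linarith

/-- A bounded super-solution on the network is bounded below by the data alone. -/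
theorem lower_bound_of_super {K : ℕ} (hK : 0 < K) {h g v : Fin K → ℝ → ℝ}
    (hglue : ∀ i j, v i 0 = v j 0) (hcont : ∀ i, ContinuousOn (v i) (Ici 0))
    (hbdd : ∃ B, ∀ i, ∀ t ≥ 0, |v i t| ≤ B) (hE : ∀ i, EdgeSuper (h i) (g i) (v i))
    (hJ : JunctionSuper h g v) {A : ℝ}
    (hA : ∀ i, ∀ t ≥ 0, ∀ p, |p| ≤ 1 → -A ≤ g i t - h i p) :
    ∀ i, ∀ t ≥ 0, -A - 1 ≤ v i t := by
  obtain ⟨B, hB⟩ := hbdd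
  intro i₀ t₀ ht₀
  have hB0 : 0 ≤ B := (abs_nonneg _).trans (hB i₀ 0 le_rfl)
  -- The proof minimizes `v i t - κ t + κ t ^ 2` over the truncated network. The choice `κ Y ^ 2 = 2
  -- B + 1` excludes the far ends, while `κ` is small enough that contact slopes stay within `[-1,
  -- 1]` and the penalty at `t₀` is negligible.
  set b := 2 * B + 1 with hb
  have hb1 : 1 ≤ b := by linarith
  set κ := 1 / (64 * b * (1 + t₀) ^ 2) with hκ
  set Y := 8 * b * (1 + t₀) with hY
  have hκ0 : 0 < κ := by positivity
  have hκY2 : κ * Y ^ 2 = b := by rw [hκ, hY]; field_simp; norm_num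
  have hκ1 : κ * (1 + t₀) ^ 2 ≤ 1 / 64 := by
    have : κ * (1 + t₀) ^ 2 = 1 / (64 * b) := by rw [hκ]; field_simp
    rw [this]
    gcongr
    linarith
  have hκY : κ * Y ≤ 1 / 8 := by
    have : κ * Y = 1 / (8 * (1 + t₀)) := by rw [hκ, hY]; field_simp; norm_num
    rw [this]
    gcongr
    linarith
  have hκ2 : κ ≤ 1 / 64 :=
    (le_mul_of_one_le_right hκ0.le (one_le_pow₀ (by linarith))).trans hκ1
  have hYt : 1 + t₀ ≤ Y := by nlinarith
  have hmin : ∀ i, ∃ t ∈ Icc 0 (Y + 1), ∀ τ ∈ Icc 0 (Y + 1),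
      v i t - κ * t + κ * t ^ 2 ≤ v i τ - κ * τ + κ * τ ^ 2 := by
    intro i
    have hc : ContinuousOn (fun t => v i t - κ * t + κ * t ^ 2) (Icc 0 (Y + 1)) :=
      (((hcont i).mono fun x hx => hx.1).sub (by fun_prop)).add (by fun_prop)
    obtain ⟨t, ht, hm⟩ := isCompact_Icc.exists_isMinOn
      ⟨0, left_mem_Icc.mpr (by linarith)⟩ hc
    exact ⟨t, ht, fun τ hτ => hm hτ⟩
  choose T hT hTm using hmin
  obtain ⟨j, -, hj⟩ := Finset.exists_min_image Finset.univ
    (fun i => v i (T i) - κ * T i + κ * T i ^ 2) ⟨i₀, Finset.mem_univ _⟩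
  have hall : ∀ i, ∀ τ ∈ Icc 0 (Y + 1),
      v j (T j) - κ * T j + κ * T j ^ 2 ≤ v i τ - κ * τ + κ * τ ^ 2 := fun i τ hτ =>
    (hj i (Finset.mem_univ _)).trans (hTm i τ hτ)
  have hlt : T j < Y + 1 := by
    refine lt_of_le_of_ne (hT j).2 fun h => ?_
    have h1 := hall j 0 ⟨le_rfl, by linarith⟩
    rw [h] at h1
    have h2 := (abs_le.mp (hB j 0 le_rfl)).2
    have h3 := (abs_le.mp (hB j (Y + 1) (by linarith))).1
    nlinarith
  have hval : -A ≤ v j (T j) := by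
    rcases (hT j).1.eq_or_lt with h0 | hpos
    · rw [← h0]
      -- The term `-κ t` makes lines of negative slope touch at the junction on every edge, so the
      -- sum of slopes is negative and the Hamiltonian alternative must hold.
      rcases hJ (fun _ => -(κ / 2)) (fun i => by
        filter_upwards [Icc_mem_nhdsGE (by norm_num : (0 : ℝ) < 1 / 2)] with t ht
        have h1 := hall i t ⟨ht.1, by linarith [ht.2]⟩
        rw [← h0, hglue j i] at h1
        have h2 : κ * t ^ 2 ≤ κ * (1 / 2 * t) := by
          gcongr
          nlinarith [ht.1, ht.2]
        nlinarith) with h | ⟨i, hi⟩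
      · rw [Finset.sum_const, Finset.card_univ, Fintype.card_fin, nsmul_eq_mul] at h
        have : (0 : ℝ) < K := by exact_mod_cast hK
        nlinarith
      · have := hA i 0 le_rfl (-(κ / 2)) (by rw [abs_neg, abs_of_pos (by positivity)]; linarith)
        rw [hglue j i]
        linarith
    · have h1 := hE j (T j) hpos (κ * (2 * T j - 1)) κ (by
        filter_upwards [Icc_mem_nhds hpos hlt] with τ hτ
        have := hall j τ hτ
        nlinarith)
      have h2 : |κ * (2 * T j - 1)| ≤ 1 := by
        have h3 : κ * T j ≤ κ * (Y + 1) := by gcongr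
        have h4 := mul_pos hκ0 hpos
        rw [abs_le]
        constructor <;> linarith
      linarith [hA j (T j) hpos.le _ h2]
  have h1 := hall i₀ t₀ ⟨ht₀, by linarith⟩
  nlinarith [mul_nonneg hκ0.le (sq_nonneg (2 * T j - 1))]

/-! ### The initial slope of a super-solution at the junction -/

/-- The infimum of the slopes of the lines that touch `v` from below at `0`. -/
noncomputable def initialSlope (v : ℝ → ℝ) : ℝ :=
  sInf {s : ℝ | ∀ᶠ t in 𝓝[≥] 0, v 0 - s * t ≤ v t}

section InitialSlope

variable {v h g : ℝ → ℝ} {L : ℝ}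

theorem bound_mem_touchingSlopes (hv : ∀ s ≥ 0, ∀ t ≥ 0, |v s - v t| ≤ L * |s - t|) :
    L ∈ {s : ℝ | ∀ᶠ t in 𝓝[≥] 0, v 0 - s * t ≤ v t} := by
  filter_upwards [self_mem_nhdsWithin] with t ht
  have h1 := (abs_le.mp (hv 0 le_rfl t ht)).2
  rw [zero_sub, abs_neg, abs_of_nonneg ht] at h1
  linarith

theorem neg_bound_mem_lowerBounds (hv : ∀ s ≥ 0, ∀ t ≥ 0, |v s - v t| ≤ L * |s - t|) :
    -L ∈ lowerBounds {s : ℝ | ∀ᶠ t in 𝓝[≥] 0, v 0 - s * t ≤ v t} := by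
  intro s hs
  have hs' : ∀ᶠ t in 𝓝[>] 0, v 0 - s * t ≤ v t :=
    Filter.Eventually.filter_mono (nhdsWithin_mono _ Ioi_subset_Ici_self) hs
  obtain ⟨t, h1, ht⟩ := (hs'.and self_mem_nhdsWithin).exists
  have ht : 0 < t := ht
  have h2 := (abs_le.mp (hv 0 le_rfl t ht.le)).1
  rw [zero_sub, abs_neg, abs_of_pos ht] at h2
  by_contra! h3
  nlinarith

theorem initialSlope_le (hv : ∀ s ≥ 0, ∀ t ≥ 0, |v s - v t| ≤ L * |s - t|) :
    initialSlope v ≤ L :=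
  csInf_le ⟨_, neg_bound_mem_lowerBounds hv⟩ (bound_mem_touchingSlopes hv)

theorem le_initialSlope (hv : ∀ s ≥ 0, ∀ t ≥ 0, |v s - v t| ≤ L * |s - t|) :
    -L ≤ initialSlope v :=
  le_csInf ⟨_, bound_mem_touchingSlopes hv⟩ (neg_bound_mem_lowerBounds hv)

theorem eventually_of_initialSlope_lt (hv : ∀ s ≥ 0, ∀ t ≥ 0, |v s - v t| ≤ L * |s - t|) {s : ℝ}
    (hs : initialSlope v < s) : ∀ᶠ t in 𝓝[≥] 0, v 0 - s * t ≤ v t := by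
  obtain ⟨s', hs', hlt⟩ := exists_lt_of_csInf_lt ⟨_, bound_mem_touchingSlopes hv⟩ hs
  filter_upwards [hs', self_mem_nhdsWithin] with t h1 ht
  have ht : 0 ≤ t := ht
  nlinarith

theorem exists_lt_of_lt_initialSlope (hv : ∀ s ≥ 0, ∀ t ≥ 0, |v s - v t| ≤ L * |s - t|)
    {s ρ : ℝ} (hs : s < initialSlope v) (hρ : 0 < ρ) : ∃ t ∈ Ioo 0 ρ, v t < v 0 - s * t := by
  by_contra! hcon
  have : s ∈ {s : ℝ | ∀ᶠ t in 𝓝[≥] 0, v 0 - s * t ≤ v t} := by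
    filter_upwards [Ico_mem_nhdsGE hρ] with t ht
    rcases ht.1.eq_or_lt with h0 | h0
    · simp [← h0]
    · exact hcon t ⟨h0, ht.2⟩
  exact absurd (csInf_le ⟨_, neg_bound_mem_lowerBounds hv⟩ this) (not_le.mpr hs)

theorem continuousOn_of_abs_sub_le {D : Set ℝ}
    (hv : ∀ s ∈ D, ∀ t ∈ D, |v s - v t| ≤ L * |s - t|) : ContinuousOn v D := by
  have : LipschitzOnWith L.toNNReal v D := by
    refine LipschitzOnWith.of_dist_le_mul fun s hs t ht => ?_
    rw [Real.dist_eq, Real.dist_eq]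
    refine (hv s hs t ht).trans ?_
    gcongr
    exact Real.le_coe_toNNReal L
  exact this.continuousOn

theorem continuousOn_of_lipschitz (hv : ∀ s ≥ 0, ∀ t ≥ 0, |v s - v t| ≤ L * |s - t|) :
    ContinuousOn v (Ici 0) :=
  continuousOn_of_abs_sub_le hv

/-- The line of slope `q` itself need not touch at `0`. But `v` stays above the line of slope `q +
η` and dips below that of slope `q - η` at some small `t₁`, which forces a parabola to touch at an
interior point with slope near `q`; continuity concludes. -/
theorem super_at_initialSlope (hv : ∀ s ≥ 0, ∀ t ≥ 0, |v s - v t| ≤ L * |s - t|)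
    (hh : Continuous h) (hg : ContinuousOn g (Ici 0)) (hE : EdgeSuper h g v) :
    g 0 ≤ v 0 + h (initialSlope v) := by
  by_contra! hlt
  set q := initialSlope v with hq
  have hvc := continuousOn_of_lipschitz hv
  obtain ⟨c, hc1, hc2⟩ := exists_between (by linarith : h q < g 0 - v 0)
  have e1 : ∀ᶠ p in 𝓝 q, h p < c := hh.continuousAt.eventually_lt_const hc1
  have e2 : ∀ᶠ t in 𝓝[≥] 0, c < g t - v t :=
    ((hg.sub hvc) 0 self_mem_Ici).eventually_const_lt hc2
  obtain ⟨η', hη', h1⟩ := Metric.eventually_nhds_iff.mp e1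
  set η := η' / 8 with hη
  have hη0 : 0 < η := by positivity
  obtain ⟨ρ, hρ, h2⟩ := (mem_nhdsGE_iff_exists_Ico_subset.mp
    (e2.and (eventually_of_initialSlope_lt hv (by linarith : q < q + η))))
  have hρ : 0 < ρ := hρ
  obtain ⟨t₁, ht₁, h3⟩ := exists_lt_of_lt_initialSlope hv (by linarith : q - η < q)
    (by positivity : 0 < ρ / 6)
  have ht0 : 0 < t₁ := ht₁.1
  have ht5 : 5 * t₁ < ρ := by linarith [ht₁.2]
  -- On `(0, 5 t₁)` the slope of this parabola stays between `q - 3 η` and `q + 7 η`, hence within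
  -- `η' = 8 η` of `q`.
  obtain ⟨t, ht, hmin⟩ := exists_interior_min
    (w := fun t => v t + (q - 3 * η) * t + η / t₁ * t ^ 2) (a := 0) (b := 5 * t₁) (c := t₁)
    (((hvc.mono fun x hx => hx.1).add (by fun_prop)).add (by fun_prop))
    ⟨ht0, by linarith⟩
    (by
      have : η / t₁ * t₁ ^ 2 = η * t₁ := by field_simp
      simp only [this]
      nlinarith)
    (by
      have a1 : η / t₁ * t₁ ^ 2 = η * t₁ := by field_simp
      have a2 : η / t₁ * (5 * t₁) ^ 2 = 25 * (η * t₁) := by field_simp; norm_num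
      have a3 := (h2 ⟨by linarith, ht5⟩ : (5 * t₁) ∈ _).2
      simp only [a1, a2]
      have := mul_pos hη0 ht0
      nlinarith)
  have h4 := hE t ht.1 (q - 3 * η + 2 * (η / t₁) * t) (η / t₁) (by
    filter_upwards [hmin] with τ hτ
    nlinarith)
  have h5 := (h2 ⟨ht.1.le, ht.2.trans ht5⟩ : t ∈ _).1
  have h6 : η / t₁ * t ≤ 5 * η := by
    have : η / t₁ * t ≤ η / t₁ * (5 * t₁) := by gcongr; exact ht.2.le
    have e : η / t₁ * (5 * t₁) = 5 * η := by field_simp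
    linarith
  have h7 : 0 ≤ η / t₁ * t := by have := ht.1; positivity
  have h8 := @h1 (q - 3 * η + 2 * (η / t₁) * t) (by
    rw [Real.dist_eq, abs_lt]
    constructor <;> linarith)
  linarith

/-- Where no line of slope `α` below the initial slope can touch from below, `v` has slope at
least `α`. -/
theorem slope_ge_of_lt_initialSlope (hv : ∀ s ≥ 0, ∀ t ≥ 0, |v s - v t| ≤ L * |s - t|)
    (hE : EdgeSuper h g v) {α r : ℝ} (hα : α < initialSlope v)
    (hr : ∀ t ∈ Ioo 0 r, v t + h α < g t) {t t' : ℝ} (ht : 0 ≤ t) (htt : t ≤ t') (ht' : t' ≤ r) :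
    v t' + α * t' ≤ v t + α * t := by
  by_contra! hlt
  have htt' : t < t' := by
    refine lt_of_le_of_ne htt fun h => ?_
    rw [h] at hlt
    linarith
  have hvc := continuousOn_of_lipschitz hv
  -- If `v t + α t` increased somewhere, then, since it also dips below its initial value, it would
  -- have an interior minimum: contact with the inadmissible slope `α`.
  obtain ⟨c, hc, h0, h1⟩ : ∃ c ∈ Ioo 0 t', v c + α * c < v 0 + α * 0 ∧
      v c + α * c < v t' + α * t' := by
    obtain ⟨c, hc, h0⟩ := exists_lt_of_lt_initialSlope hv hα (ht.trans_lt htt')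
    by_cases hcase : v t' + α * t' ≤ v 0 + α * 0
    · refine ⟨t, ⟨lt_of_le_of_ne ht fun h => ?_, htt'⟩, by linarith, hlt⟩
      rw [← h] at hlt
      linarith
    · exact ⟨c, hc, by linarith, by linarith⟩
  obtain ⟨x, hx, hmin⟩ := exists_interior_min (w := fun t => v t + α * t)
    ((hvc.mono fun x hx => hx.1).add (by fun_prop)) hc h0 h1
  have h2 := hE x hx.1 α 0 (by
    filter_upwards [hmin] with τ hτ
    linarith)
  linarith [hr x ⟨hx.1, hx.2.trans_le ht'⟩]

/-- The point `α` is the last one of `[b, q]` where `h ≤ ℓ`, or `b` if there is none. -/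
theorem exists_level_left (hh : Continuous h) {b q ℓ : ℝ} (hbq : b ≤ q) (hq : ℓ < h q) :
    ∃ α ∈ Icc b q, (∀ x ∈ Icc α q, ℓ ≤ h x) ∧ (α = b ∨ α < q ∧ h α = ℓ) := by
  by_cases hex : ∃ x ∈ Icc b q, h x ≤ ℓ
  · have hcomp : IsCompact (Icc b q ∩ {x | h x ≤ ℓ}) :=
      isCompact_Icc.inter_right (isClosed_le hh continuous_const)
    obtain ⟨α, ⟨hα, hαℓ⟩, hgr⟩ := hcomp.exists_isGreatest hex
    have hαℓ : h α ≤ ℓ := hαℓ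
    have hne : α < q := lt_of_le_of_ne hα.2 fun h => by rw [h] at hαℓ; linarith
    have hαeq : h α = ℓ := by
      obtain ⟨x, hx, hxℓ⟩ := intermediate_value_Icc hα.2 hh.continuousOn ⟨hαℓ, hq.le⟩
      have : x ≤ α := hgr ⟨⟨hα.1.trans hx.1, hx.2⟩, hxℓ.le⟩
      rwa [le_antisymm this hx.1] at hxℓ
    refine ⟨α, hα, fun x hx => ?_, Or.inr ⟨hne, hαeq⟩⟩
    by_contra! hlt
    have : x ≤ α := hgr ⟨⟨hα.1.trans hx.1, hx.2⟩, hlt.le⟩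
    rw [le_antisymm this hx.1] at hlt
    linarith
  · push Not at hex
    exact ⟨b, left_mem_Icc.mpr hbq, fun x hx => (hex x hx).le, Or.inl rfl⟩

theorem exists_level_right (hh : Continuous h) {b q ℓ : ℝ} (hbq : q ≤ b) (hq : ℓ < h q) :
    ∃ s ∈ Icc q b, (∀ x ∈ Icc q s, ℓ ≤ h x) ∧ (s = b ∨ q < s ∧ h s = ℓ) := by
  obtain ⟨α, hα, h1, h2⟩ := exists_level_left (h := fun x => h (-x)) (b := -b) (q := -q) (ℓ := ℓ)
    (hh.comp continuous_neg) (by linarith) (by simpa using hq)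
  refine ⟨-α, ⟨by linarith [hα.2], by linarith [hα.1]⟩, fun x hx => ?_, ?_⟩
  · have := h1 (-x) ⟨by linarith [hx.2], by linarith [hx.1]⟩
    simpa using this
  · rcases h2 with h | ⟨h, h'⟩
    · exact Or.inl (by linarith)
    · exact Or.inr ⟨by linarith, h'⟩

end InitialSlope

/-! ### Comparison of a sub-solution of the scheme with a viscosity super-solution -/

/-- A bounded sub-solution `U` of the scheme and a bounded Lipschitz viscosity super-solution `v`
of the problem, in the coordinate `t = -x`. -/
structure SubSuperPair {K : ℕ} (L₁ L₂ L L' B : ℝ) (C₀ : Fin K → ℝ) (Δx ε : ℝ) (h g v : Fin K → ℝ → ℝ)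
    (G : Fin K → ℝ → ℝ → ℝ) (U : Fin K → ℕ → ℝ) : Prop where
  mesh_pos : 0 < Δx
  lt_viscosity : L₁ * Δx < ε
  viscosity_le : ε ≤ L₂ * Δx
  continuous_ham : ∀ i, Continuous (h i)
  source_lipschitz : ∀ i, ∀ s ≥ 0, ∀ t ≥ 0, |g i s - g i t| ≤ L' * |s - t|
  flux_lipschitz : ∀ i, ∀ p₁ p₂ q₁ q₂ : ℝ,
    |G i p₁ p₂ - G i q₁ q₂| ≤ L₁ * (|p₁ - q₁| + |p₂ - q₂|)
  -- Only a lower bound on `G i p p` is needed, and `truncation` makes the capped case harmless: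
  -- there the residual would be at least `1`. In this form the hypotheses also cover the negated
  -- problem.
  consistent : ∀ i p, min (h i p) (C₀ i) ≤ G i p p
  truncation : ∀ i (m : ℕ), 1 ≤ U i m + C₀ i - g i (m * Δx)
  grid_glued : GridGlued U
  grid_bound : ∀ i m, |U i m| ≤ B
  grid_edge : ∀ i (m : ℕ), m ≠ 0 →
    U i m + schemeOp Δx ε (G i) (Dplus Δx (U i) m) (Dminus Δx (U i) m) ≤ g i (m * Δx)
  grid_junction : ∀ i, U i 0 ≤ 1 / (K : ℝ) * ∑ j, U j 1
  glued : ∀ i j, v i 0 = v j 0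
  bound : ∀ i, ∀ t ≥ 0, |v i t| ≤ B
  lipschitz : ∀ i, ∀ s ≥ 0, ∀ t ≥ 0, |v i s - v i t| ≤ L * |s - t|
  edge : ∀ i, EdgeSuper (h i) (g i) (v i)
  junction : JunctionSuper h g v

/-- The functional maximized in the doubling of variables, with a tilt `α` and a penalization
beyond `T`. -/
noncomputable def doubled (Δx d α T : ℝ) (U : ℕ → ℝ) (v : ℝ → ℝ) (m : ℕ) (η : ℝ) : ℝ :=
  U m - v η - (m * Δx - η) ^ 2 / (2 * d) + α * (m * Δx - η) - d * max (m * Δx - T) 0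

/-- `(m, η)` maximizes `doubled` beyond the node `N`. -/
def IsDoubledMax (Δx d α T : ℝ) (U : ℕ → ℝ) (v : ℝ → ℝ) (N m : ℕ) (η : ℝ) : Prop :=
  N ≤ m ∧ N * Δx ≤ η ∧ ∀ m' : ℕ, N ≤ m' → ∀ η', N * Δx ≤ η' →
    doubled Δx d α T U v m' η' ≤ doubled Δx d α T U v m η

/-- The quadratic absorbs the tilt and the penalty beyond `T` restores compactness: outside a
bounded set the functional is below its value at `(N, N Δx)`. -/
theorem exists_isDoubledMax {Δx d α T B : ℝ} {U : ℕ → ℝ} {v : ℝ → ℝ} (hΔ : 0 < Δx) (hd : 0 < d)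
    (hU : ∀ m, |U m| ≤ B) (hv : ∀ t ≥ 0, |v t| ≤ B) (hvc : ContinuousOn v (Ici 0)) (N : ℕ) :
    ∃ m η, IsDoubledMax Δx d α T U v N m η := by
  have hN : 0 ≤ N * Δx := by positivity
  set c := doubled Δx d α T U v N (N * Δx) with hc
  set Q := |2 * B + α ^ 2 * d - c| + 1 with hQ
  have hQ1 : 1 ≤ Q := by linarith [abs_nonneg (2 * B + α ^ 2 * d - c)]
  have hQc : 2 * B + α ^ 2 * d - Q < c := by
    linarith [le_abs_self (2 * B + α ^ 2 * d - c)]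
  have hupper : ∀ (m : ℕ) (η : ℝ), 0 ≤ η → doubled Δx d α T U v m η ≤
      2 * B + α ^ 2 * d - (m * Δx - η) ^ 2 / (4 * d) - d * max (m * Δx - T) 0 := by
    intro m η hη
    have h1 := (abs_le.mp (hU m)).2
    have h2 := (abs_le.mp (hv η hη)).1
    have h3 : α * (m * Δx - η) ≤ α ^ 2 * d + (m * Δx - η) ^ 2 / (4 * d) := by
      have e : α ^ 2 * d + (m * Δx - η) ^ 2 / (4 * d) - α * (m * Δx - η)
          = (2 * d * α - (m * Δx - η)) ^ 2 / (4 * d) := by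
        field_simp
        ring
      have : 0 ≤ (2 * d * α - (m * Δx - η)) ^ 2 / (4 * d) := by positivity
      linarith
    have h4 : (m * Δx - η) ^ 2 / (2 * d) = 2 * ((m * Δx - η) ^ 2 / (4 * d)) := by
      field_simp
      norm_num
    unfold doubled
    rw [h4]
    linarith
  obtain ⟨M, hM⟩ := exists_nat_gt ((|T| + Q / d) / Δx)
  rw [div_lt_iff₀ hΔ] at hM
  set E := (max M N : ℕ) * Δx + 4 * d + Q with hE
  have hMN : (M : ℝ) ≤ (max M N : ℕ) := by exact_mod_cast le_max_left M N
  have hNM : (N : ℝ) ≤ (max M N : ℕ) := by exact_mod_cast le_max_right M N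
  have hcomp : IsCompact ((Icc N (max M N) : Set ℕ) ×ˢ (Icc (N * Δx) E : Set ℝ)) :=
    (Set.finite_Icc _ _).isCompact.prod isCompact_Icc
  have hcont : ContinuousOn (fun z : ℕ × ℝ => doubled Δx d α T U v z.1 z.2)
      ((Icc N (max M N) : Set ℕ) ×ˢ (Icc (N * Δx) E : Set ℝ)) := by
    have hU' : Continuous fun z : ℕ × ℝ => U z.1 := continuous_of_discreteTopology.comp continuous_fst
    have hc' : Continuous fun z : ℕ × ℝ => (z.1 : ℝ) :=
      (continuous_of_discreteTopology (f := fun n : ℕ => (n : ℝ))).comp continuous_fst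
    have hv' : ContinuousOn (fun z : ℕ × ℝ => v z.2)
        ((Icc N (max M N) : Set ℕ) ×ˢ (Icc (N * Δx) E : Set ℝ)) :=
      hvc.comp continuous_snd.continuousOn fun z hz => hN.trans hz.2.1
    have hrest : Continuous fun z : ℕ × ℝ => -((z.1 * Δx - z.2) ^ 2 / (2 * d))
        + α * (z.1 * Δx - z.2) - d * max (z.1 * Δx - T) 0 := by fun_prop
    refine ((hU'.continuousOn.sub hv').add hrest.continuousOn).congr fun z _ => ?_
    simp only [doubled, Pi.add_apply, Pi.sub_apply]
    ring
  have hNE : N * Δx ≤ E := by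
    have : N * Δx ≤ (max M N : ℕ) * Δx := by gcongr
    linarith
  obtain ⟨⟨m, η⟩, ⟨hm, hη⟩, hmax⟩ := hcomp.exists_isMaxOn
    ⟨(N, N * Δx), ⟨le_rfl, le_max_right _ _⟩, le_rfl, hNE⟩ hcont
  have hmax' : ∀ m' η', m' ∈ Icc N (max M N) → η' ∈ Icc (N * Δx) E →
      doubled Δx d α T U v m' η' ≤ doubled Δx d α T U v m η :=
    fun m' η' h₁ h₂ => hmax (mk_mem_prod h₁ h₂)
  have hmaxc : c ≤ doubled Δx d α T U v m η :=
    hmax' N (N * Δx) ⟨le_rfl, le_max_right _ _⟩ ⟨le_rfl, hNE⟩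
  refine ⟨m, η, hm.1, hη.1, fun m' hm' η' hη' => ?_⟩
  have hη0 : 0 ≤ η' := hN.trans hη'
  by_cases h1 : m' ≤ max M N
  · by_cases h2 : η' ≤ E
    · exact hmax' m' η' ⟨hm', h1⟩ ⟨hη', h2⟩
    · refine le_trans ?_ hmaxc
      have h3 := hupper m' η' hη0
      have h4 : m' * Δx ≤ (max M N : ℕ) * Δx := by gcongr
      have h5 : Q ≤ (m' * Δx - η') ^ 2 / (4 * d) := by
        rw [le_div_iff₀ (by positivity)]
        have h6 : 4 * d + Q ≤ η' - m' * Δx := by linarith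
        nlinarith
      have h7 : 0 ≤ d * max (m' * Δx - T) 0 := mul_nonneg hd.le (le_max_right _ _)
      linarith
  · refine le_trans ?_ hmaxc
    have h3 := hupper m' η' hη0
    have h4 : (max M N : ℕ) ≤ (m' : ℝ) := by exact_mod_cast (not_le.mp h1).le
    have h5 : M * Δx ≤ m' * Δx := by gcongr; exact_mod_cast hMN.trans h4
    have h6 : Q / d ≤ max (m' * Δx - T) 0 := by
      refine le_trans ?_ (le_max_left _ _)
      linarith [le_abs_self T]
    have h7 : Q ≤ d * max (m' * Δx - T) 0 := by
      rw [div_le_iff₀ hd] at h6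
      linarith
    have h8 : 0 ≤ (m' * Δx - η') ^ 2 / (4 * d) := by positivity
    linarith

/-- Comparison with `η = m Δx`, always admissible, so boundary maxima are covered too. -/
theorem IsDoubledMax.abs_sub_le {Δx d α T L : ℝ} {U : ℕ → ℝ} {v : ℝ → ℝ} {N m : ℕ} {η : ℝ}
    (hmax : IsDoubledMax Δx d α T U v N m η) (hΔ : 0 < Δx) (hd : 0 < d)
    (hv : ∀ s ≥ 0, ∀ t ≥ 0, |v s - v t| ≤ L * |s - t|) (hα : |α| ≤ L) :
    |m * Δx - η| ≤ 4 * L * d := by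
  obtain ⟨hm, hη, h⟩ := hmax
  have hN : 0 ≤ N * Δx := by positivity
  have hm' : N * Δx ≤ m * Δx := by gcongr
  have h1 := h m hm (m * Δx) hm'
  have h2 := (abs_le.mp (hv (m * Δx) (hN.trans hm') η (hN.trans hη))).2
  unfold doubled at h1
  rw [sub_self] at h1
  have h3 : α * (m * Δx - η) ≤ L * |m * Δx - η| := by
    refine (le_abs_self _).trans ?_
    rw [abs_mul]
    gcongr
  have h4 : (m * Δx - η) ^ 2 / (2 * d) ≤ 2 * L * |m * Δx - η| := by
    have e : (0 : ℝ) ^ 2 / (2 * d) = 0 := by simp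
    rw [e] at h1
    linarith
  rw [div_le_iff₀ (by positivity), ← sq_abs] at h4
  rcases (abs_nonneg (m * Δx - η)).eq_or_lt with h0 | h0
  · rw [← h0]
    have : 0 ≤ L := (abs_nonneg _).trans hα
    positivity
  · nlinarith

/-- The constant of the estimate at interior maxima of `doubled`. -/
noncomputable def interiorConst (L₁ L₂ L L' : ℝ) : ℝ :=
  4 * L * L' + 4 * L ^ 2 + 2 * (L₁ + L₂)

/-! ### Interior estimate, propagation along an edge, and decay of discrete slopes. -/

section Pair

variable {K : ℕ} {L₁ L₂ L L' B Δx ε : ℝ} {C₀ : Fin K → ℝ} {h g v : Fin K → ℝ → ℝ}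
  {G : Fin K → ℝ → ℝ → ℝ} {U : Fin K → ℕ → ℝ}

/-- At the maximum `v` has contact slope `q`, and the discrete slopes of `U` are bounded on the
relevant sides by `q` up to `O(d)`: the quadratic contributes `Δx / (2 d) = d / 2`, the penalty at
most `d`. Subtracting the two inequalities leaves the source and tilt errors, controlled by the
`O(d)` separation. -/
theorem SubSuperPair.doubled_le_of_interior (P : SubSuperPair L₁ L₂ L L' B C₀ Δx ε h g v G U)
    {d α T η : ℝ} {N m : ℕ} {i : Fin K} (hd : 0 < d) (hΔd : Δx = d ^ 2) (hα : |α| ≤ L)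
    (hL' : 0 ≤ L') (hsmall : 2 * (L₁ + L₂) * d < 1)
    (hmax : IsDoubledMax Δx d α T (U i) (v i) N m η) (hm : N < m) (hη : N * Δx < η) :
    doubled Δx d α T (U i) (v i) m η ≤ interiorConst L₁ L₂ L L' * d := by
  have hΔ := P.mesh_pos
  have hz := hmax.abs_sub_le hΔ hd (P.lipschitz i) hα
  have hN : 0 ≤ N * Δx := by positivity
  obtain ⟨-, -, hmx⟩ := hmax
  set τ := m * Δx with hτ
  have hτ0 : 0 ≤ τ := by positivity
  set q := α - (τ - η) / d with hq
  have hsuper : g i η ≤ v i η + h i q := by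
    refine P.edge i η (hN.trans_lt hη) q (1 / (2 * d)) ?_
    filter_upwards [Ioi_mem_nhds hη] with σ hσ
    have h1 := hmx m hm.le σ (le_of_lt hσ)
    unfold doubled at h1
    rw [← hτ] at h1
    have e : (τ - σ) ^ 2 / (2 * d) = (τ - η) ^ 2 / (2 * d) - (τ - η) / d * (σ - η)
        + 1 / (2 * d) * (σ - η) ^ 2 := by
      field_simp
      ring
    rw [e] at h1
    rw [hq]
    linarith
  have hplus : Dplus Δx (U i) m ≤ q + d / 2 := by
    obtain ⟨n, rfl⟩ : ∃ n, m = n + 1 := ⟨m - 1, by omega⟩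
    have h1 := hmx n (by omega) η hη.le
    unfold doubled at h1
    have h2 : d * max (n * Δx - T) 0 ≤ d * max (τ - T) 0 := by
      gcongr
      rw [hτ]
      gcongr
      simp
    have e0 : n * Δx = τ - Δx := by rw [hτ]; push_cast; ring
    rw [e0] at h1 h2
    rw [← hτ] at h1
    unfold Dplus
    rw [Nat.add_sub_cancel, div_le_iff₀ hΔ]
    have e1 : (τ - Δx - η) ^ 2 / (2 * d) = (τ - η) ^ 2 / (2 * d) - (τ - η) / d * Δx
        + d / 2 * Δx := by
      rw [hΔd]
      field_simp
      ring
    rw [e1] at h1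
    rw [hq]
    linarith
  have hminus : q - 3 * d / 2 ≤ Dminus Δx (U i) m := by
    have h1 := hmx (m + 1) (by omega) η hη.le
    unfold doubled at h1
    have e0 : ((m + 1 : ℕ) : ℝ) * Δx = τ + Δx := by rw [hτ]; push_cast; ring
    rw [e0, ← hτ] at h1
    have h2 : d * max (τ + Δx - T) 0 ≤ d * (max (τ - T) 0 + Δx) := by
      gcongr
      refine max_le ?_ ?_
      · linarith [le_max_left (τ - T) 0]
      · linarith [le_max_right (τ - T) 0]
    unfold Dminus
    rw [le_div_iff₀ hΔ]
    have e1 : (τ + Δx - η) ^ 2 / (2 * d) = (τ - η) ^ 2 / (2 * d) + (τ - η) / d * Δx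
        + d / 2 * Δx := by
      rw [hΔd]
      field_simp
      ring
    rw [e1] at h1
    rw [hq]
    linarith
  have hgrid := P.grid_edge i m (by omega)
  have hF := schemeOp_le_schemeOp hΔ P.lt_viscosity.le (P.flux_lipschitz i) hplus hminus
  have hF' : G i q q - 2 * (L₁ + L₂) * d ≤ schemeOp Δx ε (G i) (q + d / 2) (q - 3 * d / 2) := by
    have h1 := (abs_le.mp (P.flux_lipschitz i (q + d / 2) (q - 3 * d / 2) q q)).1
    have e1 : q + d / 2 - q = d / 2 := by ring
    have e2 : q - 3 * d / 2 - q = -(3 * d / 2) := by ring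
    rw [e1, e2, abs_neg, abs_of_pos (by positivity), abs_of_pos (by positivity)] at h1
    have h2 : ε / Δx ≤ L₂ := by
      rw [div_le_iff₀ hΔ]
      exact P.viscosity_le
    have h3 : ε / Δx * (2 * d) ≤ L₂ * (2 * d) := by gcongr
    have e3 : q + d / 2 - (q - 3 * d / 2) = 2 * d := by ring
    unfold schemeOp
    rw [e3]
    linarith
  have htr := P.truncation i m
  rw [← hτ] at htr hgrid
  have hcons : h i q ≤ G i q q := by
    rcases min_le_iff.mp (P.consistent i q) with h1 | h1
    · exact h1
    · linarith
  have hg := (abs_le.mp (P.source_lipschitz i τ hτ0 η (hN.trans hη.le))).2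
  have hgz : L' * |τ - η| ≤ L' * (4 * L * d) := by gcongr
  have hαz : α * (τ - η) ≤ L * (4 * L * d) := by
    refine (le_abs_self _).trans ?_
    rw [abs_mul]
    have : 0 ≤ L := (abs_nonneg _).trans hα
    gcongr
  have hsq : 0 ≤ (τ - η) ^ 2 / (2 * d) := by positivity
  have hpen : 0 ≤ d * max (τ - T) 0 := mul_nonneg hd.le (le_max_right _ _)
  unfold doubled interiorConst
  rw [← hτ]
  linarith

/-- A bound at the junction propagates to the edges. -/
theorem SubSuperPair.le_of_junction_le (P : SubSuperPair L₁ L₂ L L' B C₀ Δx ε h g v G U)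
    {d a : ℝ} {i : Fin K} (hd : 0 < d) (hΔd : Δx = d ^ 2) (hL : 0 ≤ L) (hL' : 0 ≤ L') (ha : 0 ≤ a)
    (hL₁ : 0 ≤ L₁) (hL₂ : 0 ≤ L₂)
    (hsmall : 2 * (L₁ + L₂) * d < 1) (h0 : U i 0 - v i 0 ≤ a) (m : ℕ) :
    U i m - v i (m * Δx) ≤ a + (interiorConst L₁ L₂ L L' + 8 * L ^ 2) * d := by
  have hΔ := P.mesh_pos
  have hα : |-L| ≤ L := by rw [abs_neg, abs_of_nonneg hL]
  have hC : 0 ≤ interiorConst L₁ L₂ L L' := by unfold interiorConst; positivity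
  have hCd : 0 ≤ interiorConst L₁ L₂ L L' * d := by positivity
  have hLd : 0 ≤ 8 * L ^ 2 * d := by positivity
  -- The tilt `-L` rules out `η = 0 < n`: moving `η` up to `n Δx` costs at most `L n Δx` in `v`,
  -- which the tilt repays.
  obtain ⟨n, η, hmax⟩ := exists_isDoubledMax (α := -L) (T := m * Δx) hΔ hd (P.grid_bound i)
    (P.bound i) (continuousOn_of_lipschitz (P.lipschitz i)) 0
  have hz := hmax.abs_sub_le hΔ hd (P.lipschitz i) hα
  have hval : U i m - v i (m * Δx) ≤ doubled Δx d (-L) (m * Δx) (U i) (v i) n η := by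
    have := hmax.2.2 m (Nat.zero_le _) (m * Δx) (by simp; positivity)
    refine le_trans ?_ this
    simp [doubled]
  refine hval.trans ?_
  have hη0 : 0 ≤ η := by simpa using hmax.2.1
  rcases Nat.eq_zero_or_pos n with rfl | hn
  · have h1 := (abs_le.mp (P.lipschitz i 0 le_rfl η hη0)).2
    simp only [Nat.cast_zero, zero_mul, zero_sub, abs_neg, abs_of_nonneg hη0] at h1 hz
    have h2 : L * η ≤ L * (4 * L * d) := by gcongr
    have h3 : 0 ≤ (-η) ^ 2 / (2 * d) := by positivity
    have h4 : 0 ≤ d * max (-(m * Δx)) 0 := mul_nonneg hd.le (le_max_right _ _)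
    simp only [doubled, Nat.cast_zero, zero_mul, zero_sub]
    linarith
  · rcases hη0.eq_or_lt with h1 | h1
    · exfalso
      have hτ : 0 < n * Δx := by positivity
      have h2 := hmax.2.2 n (Nat.zero_le _) (n * Δx) (by simpa using hτ.le)
      have h3 := (abs_le.mp (P.lipschitz i (n * Δx) hτ.le 0 le_rfl)).2
      rw [← h1] at h2
      simp only [doubled, sub_self, sub_zero] at h2 h3
      rw [abs_of_pos hτ] at h3
      have h4 : 0 < (n * Δx) ^ 2 / (2 * d) := by positivity
      have h5 : (0 : ℝ) ^ 2 / (2 * d) = 0 := by simp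
      rw [h5] at h2
      linarith
    · have := P.doubled_le_of_interior hd hΔd hα hL' hsmall hmax hn (by simpa using h1)
      linarith

/-- The discrete slope decreases at a definite rate until it leaves a range of slopes that the
scheme does not admit. -/
theorem discrete_slope_le {L₁ Δx ε α s S b r : ℝ} {G : ℝ → ℝ → ℝ} {g : ℝ → ℝ} {U : ℕ → ℝ}
    (hΔ : 0 < Δx) (hε : L₁ * Δx < ε) (hL₁ : 0 ≤ L₁)
    (hG : ∀ p₁ p₂ q₁ q₂ : ℝ, |G p₁ p₂ - G q₁ q₂| ≤ L₁ * (|p₁ - q₁| + |p₂ - q₂|))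
    (hU : ∀ m : ℕ, m ≠ 0 →
      U m + schemeOp Δx ε G (Dplus Δx U m) (Dminus Δx U m) ≤ g (m * Δx))
    (hαs : α ≤ s) (hsS : s ≤ S) (hb : 0 < b)
    (hlevel : ∀ m : ℕ, m * Δx ≤ r → U 0 - S * (m * Δx) ≤ U m →
      ∀ x ∈ Icc α s, b ≤ U m + G x x - g (m * Δx))
    (h1 : Dplus Δx U 1 ≤ s) (n : ℕ) (hn : n * Δx ≤ r) :
    Dplus Δx U (n + 1) ≤ max α (s - n * (b * Δx / (2 * ε))) ∧
      U 0 - S * ((n + 1 : ℕ) * Δx) ≤ U (n + 1) := by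
  have hε0 : 0 < ε := lt_of_le_of_lt (by positivity) hε
  have hκ : L₁ < ε / Δx := by rwa [lt_div_iff₀ hΔ]
  have hstep : ∀ n : ℕ, U (n + 1) = U n - Dplus Δx U (n + 1) * Δx := by
    intro n
    unfold Dplus
    rw [Nat.add_sub_cancel]
    field_simp
    ring
  induction n with
  | zero =>
    refine ⟨by simp [h1], ?_⟩
    have := hstep 0
    have h2 : Dplus Δx U (0 + 1) * Δx ≤ S * Δx := by gcongr; exact h1.trans hsS
    push_cast
    linarith
  | succ n ih =>
    have hn' : n * Δx ≤ r := by
      refine le_trans ?_ hn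
      gcongr
      simp
    obtain ⟨ih1, ih2⟩ := ih hn'
    have hl := hlevel (n + 1) hn ih2
    have hsch := hU (n + 1) (Nat.succ_ne_zero n)
    have hD : Dminus Δx U (n + 1) = Dplus Δx U (n + 2) := rfl
    rw [hD] at hsch
    set p := Dplus Δx U (n + 1) with hp
    set p' := Dplus Δx U (n + 2) with hp'
    have hstepκ : 0 < b * Δx / (2 * ε) := by positivity
    have hle : p' ≤ max α (s - (n + 1 : ℕ) * (b * Δx / (2 * ε))) := by
      rcases le_or_gt p α with hpα | hpα
      · refine le_max_of_le_left ?_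
        by_contra! hlt
        have h2 := schemeOp_le_schemeOp hΔ hε.le hG hpα hlt.le
        have h3 : schemeOp Δx ε G α α = G α α := by simp [schemeOp]
        linarith [hl α ⟨le_rfl, hαs⟩]
      · have hpn : p ≤ s - n * (b * Δx / (2 * ε)) :=
          (le_max_iff.mp ih1).resolve_left (not_le.mpr hpα)
        have hps : p ≤ s := by
          have : 0 ≤ n * (b * Δx / (2 * ε)) := by positivity
          linarith
        have h2 := hl p ⟨hpα.le, hps⟩
        have h3 := (abs_le.mp (hG p p' p p)).1
        rw [sub_self, abs_zero, zero_add] at h3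
        unfold schemeOp at hsch
        refine le_max_of_le_right ?_
        -- The flux residual at `p` is at least `b`, so the viscous term must compensate by a drop
        -- of at least `b Δx / (2 ε)`. A rise is impossible because `L₁ < ε / Δx` strictly.
        rcases le_or_gt p' p with hpp | hpp
        · rw [abs_of_nonpos (by linarith)] at h3
          have h4 : b ≤ 2 * (ε / Δx) * (p - p') := by
            nlinarith [mul_nonneg (sub_nonneg.mpr hκ.le) (sub_nonneg.mpr hpp)]
          have h5 : b * Δx / (2 * ε) ≤ p - p' := by
            rw [div_le_iff₀ (by positivity)]
            have e : 2 * (ε / Δx) * (p - p') = 2 * ε * (p - p') / Δx := by ring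
            rw [e, le_div_iff₀ hΔ] at h4
            linarith
          push_cast
          linarith
        · exfalso
          rw [abs_of_pos (by linarith)] at h3
          nlinarith [mul_pos (sub_pos.mpr hκ) (sub_pos.mpr hpp)]
    refine ⟨hle, ?_⟩
    have h2 : p' ≤ s := by
      refine hle.trans (max_le hαs ?_)
      have : 0 ≤ ((n + 1 : ℕ) : ℝ) * (b * Δx / (2 * ε)) := by positivity
      linarith
    have h3 := hstep (n + 1)
    have h4 : p' * Δx ≤ S * Δx := by gcongr; exact h2.trans hsS
    rw [show n + 1 + 1 = n + 2 from rfl] at *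
    rw [← hp'] at h3
    push_cast at ih2 ⊢
    linarith

end Pair

/-! ### The estimate at the junction. -/

section Junction

variable {K : ℕ} {L₁ L₂ L L' B Δx ε : ℝ} {C₀ : Fin K → ℝ} {h g v : Fin K → ℝ → ℝ}
  {G : Fin K → ℝ → ℝ → ℝ} {U : Fin K → ℕ → ℝ}

/-- The constant of the estimate at the junction. -/
noncomputable def junctionConst (K : ℕ) (L₁ L₂ L L' : ℝ) : ℝ :=
  16 * (K * L) * L₂ + 4 * (K * L + L' + L + 1) * (4 * L + 8) + 2 * (K * L + L)
    + interiorConst L₁ L₂ L L'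

theorem SubSuperPair.sum_Dplus_nonpos (P : SubSuperPair L₁ L₂ L L' B C₀ Δx ε h g v G U) :
    ∑ j, Dplus Δx (U j) 1 ≤ 0 := by
  rcases Nat.eq_zero_or_pos K with rfl | hK
  · simp
  have hK' : (0 : ℝ) < K := by exact_mod_cast hK
  have h1 := P.grid_junction ⟨0, hK⟩
  have h2 : ∑ j, U j 0 = K * U ⟨0, hK⟩ 0 := by
    rw [Finset.sum_congr rfl fun j _ => P.grid_glued j ⟨0, hK⟩, Finset.sum_const, Finset.card_univ,
      Fintype.card_fin, nsmul_eq_mul]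
  have h3 : ∑ j, Dplus Δx (U j) 1 = (∑ j, U j 0 - ∑ j, U j 1) / Δx := by
    rw [← Finset.sum_sub_distrib, Finset.sum_div]
    rfl
  rw [h3, h2]
  refine div_nonpos_of_nonpos_of_nonneg ?_ P.mesh_pos.le
  have h4 := mul_le_mul_of_nonneg_left h1 hK'.le
  rw [← mul_assoc, mul_one_div_cancel hK'.ne', one_mul] at h4
  linarith

/-- If `U` exceeds `v` at the junction, the Kirchhoff conditions produce an edge on which the
initial discrete slope of `U` and the initial slope of `v` lie in one interval of slopes on which
the Hamiltonian is large. -/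
theorem SubSuperPair.exists_edge (P : SubSuperPair L₁ L₂ L L' B C₀ Δx ε h g v G U) (hK : 0 < K)
    (hL : 0 ≤ L) {a : ℝ} (ha : 0 < a) :
    ∃ j, ∃ s ∈ Icc (initialSlope (v j)) (K * L), Dplus Δx (U j) 1 ≤ s ∧
      ∀ x ∈ Icc (initialSlope (v j)) s, g j 0 - v j 0 - a ≤ h j x := by
  have hK1 : (1 : ℝ) ≤ K := by exact_mod_cast hK
  have hKL : L ≤ K * L := le_mul_of_one_le_left hL hK1
  have hlev : ∀ j, ∃ s ∈ Icc (initialSlope (v j)) (K * L),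
      (∀ x ∈ Icc (initialSlope (v j)) s, g j 0 - v j 0 - a ≤ h j x) ∧
      (s = K * L ∨ initialSlope (v j) < s ∧ h j s = g j 0 - v j 0 - a) := fun j => by
    refine exists_level_right (P.continuous_ham j) ((initialSlope_le (P.lipschitz j)).trans hKL) ?_
    have := super_at_initialSlope (P.lipschitz j) (P.continuous_ham j)
      (continuousOn_of_lipschitz (P.source_lipschitz j)) (P.edge j)
    linarith
  choose s hs hsl hs' using hlev
  -- One value `K L` outweighs the others, all at least `-L`. Otherwise every `s i` exceeds the
  -- initial slope, so these lines touch `v`, and the level reached at `s i` excludes the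
  -- Hamiltonian alternative.
  have hsum : 0 ≤ ∑ j, s j := by
    by_cases hex : ∃ j, s j = K * L
    · obtain ⟨j, hj⟩ := hex
      have hnn : ∀ i, 0 ≤ s i + L := fun i => by
        linarith [(hs i).1, le_initialSlope (P.lipschitz i)]
      have h1 : s j + L ≤ ∑ i, (s i + L) :=
        Finset.single_le_sum (f := fun i => s i + L) (fun i _ => hnn i) (Finset.mem_univ j)
      rw [Finset.sum_add_distrib, Finset.sum_const, Finset.card_univ, Fintype.card_fin,
        nsmul_eq_mul] at h1
      linarith
    · push Not at hex
      rcases P.junction s fun i => eventually_of_initialSlope_lt (P.lipschitz i)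
        ((hs' i).resolve_left (hex i)).1 with h1 | ⟨i, hi⟩
      · exact h1
      · linarith [((hs' i).resolve_left (hex i)).2]
  obtain ⟨j, hj⟩ : ∃ j, Dplus Δx (U j) 1 ≤ s j := by
    by_contra! hlt
    have := Finset.sum_lt_sum_of_nonempty (s := Finset.univ)
      ⟨(⟨0, hK⟩ : Fin K), Finset.mem_univ _⟩ fun i _ => hlt i
    linarith [P.sum_Dplus_nonpos]
  exact ⟨j, s j, hs j, hj, hsl j⟩

/-- Where both functions have slopes on the right side of `α` near the node `N`, the doubling has
no maximum on the boundary. -/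
theorem SubSuperPair.le_of_slopes (P : SubSuperPair L₁ L₂ L L' B C₀ Δx ε h g v G U)
    {d α r : ℝ} {N : ℕ} {j : Fin K} (hd : 0 < d) (hΔd : Δx = d ^ 2) (hα : |α| ≤ L)
    (hL' : 0 ≤ L') (hsmall : 2 * (L₁ + L₂) * d < 1)
    (hN : N * Δx + 4 * L * d + Δx ≤ r)
    (hU : ∀ n, N ≤ n → n * Δx ≤ r → Dplus Δx (U j) (n + 1) ≤ α)
    (hv : ∀ t t', 0 ≤ t → t ≤ t' → t' ≤ r → v j t' + α * t' ≤ v j t + α * t) :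
    U j N - v j (N * Δx) ≤ interiorConst L₁ L₂ L L' * d := by
  have hΔ := P.mesh_pos
  have hL : 0 ≤ L := (abs_nonneg _).trans hα
  have hN0 : 0 ≤ N * Δx := by positivity
  have hLd : 0 ≤ 4 * L * d := by positivity
  obtain ⟨m, η, hmax⟩ := exists_isDoubledMax (α := α) (T := r) hΔ hd (P.grid_bound j)
    (P.bound j) (continuousOn_of_lipschitz (P.lipschitz j)) N
  have hval : U j N - v j (N * Δx) ≤ doubled Δx d α r (U j) (v j) m η := by
    refine le_trans ?_ (hmax.2.2 N le_rfl (N * Δx) le_rfl)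
    simp only [doubled, sub_self]
    rw [max_eq_right (by linarith)]
    simp
  refine hval.trans ?_
  by_cases hint : N < m ∧ N * Δx < η
  · exact P.doubled_le_of_interior hd hΔd hα hL' hsmall hmax hint.1 hint.2
  · have hz := abs_le.mp (hmax.abs_sub_le hΔ hd (P.lipschitz j) hα)
    have hmr : m * Δx ≤ N * Δx + 4 * L * d ∧ η ≤ N * Δx + 4 * L * d := by
      by_cases h1 : N < m
      · have h2 : η ≤ N * Δx := not_lt.mp fun h3 => hint ⟨h1, h3⟩
        constructor <;> linarith [hz.2]
      · have h2 : m = N := le_antisymm (not_lt.mp h1) hmax.1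
        subst h2
        constructor <;> linarith [hz.1]
    have e : ((m + 1 : ℕ) : ℝ) * Δx = m * Δx + Δx := by push_cast; ring
    -- A boundary maximum is near `N`, where the penalty vanishes. Shifting both variables by `Δx`
    -- keeps their separation, and `U` then loses at most `α Δx` while `v` loses at least that much.
    have hshift : doubled Δx d α r (U j) (v j) m η ≤
        doubled Δx d α r (U j) (v j) (m + 1) (η + Δx) := by
      have h1 := hU m hmax.1 (by linarith)
      have h2 := hv η (η + Δx) (hN0.trans hmax.2.1) (by linarith) (by linarith)
      unfold Dplus at h1
      rw [Nat.add_sub_cancel, div_le_iff₀ hΔ] at h1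
      simp only [doubled, e]
      rw [max_eq_right (by linarith), max_eq_right (by linarith)]
      have e2 : m * Δx + Δx - (η + Δx) = m * Δx - η := by ring
      rw [e2]
      linarith
    have hmax' : IsDoubledMax Δx d α r (U j) (v j) N (m + 1) (η + Δx) :=
      ⟨hmax.1.trans (Nat.le_succ m), by linarith [hmax.2.1], fun m' hm' η' hη' =>
        (hmax.2.2 m' hm' η' hη').trans hshift⟩
    exact hshift.trans (P.doubled_le_of_interior hd hΔd hα hL' hsmall hmax'
      (Nat.lt_succ_of_le hmax.1) (by linarith [hmax.2.1]))

theorem SubSuperPair.junction_le (P : SubSuperPair L₁ L₂ L L' B C₀ Δx ε h g v G U) (hK : 0 < K)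
    {d : ℝ} (hd : 0 < d) (hΔd : Δx = d ^ 2) (hL : 0 ≤ L) (hL' : 0 ≤ L') (hL₁ : 0 ≤ L₁)
    (hL₂ : 0 ≤ L₂) (hsmall : junctionConst K L₁ L₂ L L' * d ≤ 1) (i : Fin K) :
    U i 0 - v i 0 ≤ junctionConst K L₁ L₂ L L' * d := by
  by_contra! hlt
  have hΔ := P.mesh_pos
  have hK1 : (1 : ℝ) ≤ K := by exact_mod_cast hK
  have hKL : L ≤ K * L := le_mul_of_one_le_left hL hK1
  set S := K * L with hS
  have hS0 : 0 ≤ S := hL.trans hKL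
  set I := interiorConst L₁ L₂ L L' with hI
  have hI0 : 2 * (L₁ + L₂) ≤ I := by
    have : 0 ≤ 4 * L * L' + 4 * L ^ 2 := by positivity
    simp only [hI, interiorConst]
    linarith
  set A := junctionConst K L₁ L₂ L L' with hA
  have hAdef : A = 16 * S * L₂ + 4 * (S + L' + L + 1) * (4 * L + 8) + 2 * (S + L) + I := rfl
  have hprod : 32 ≤ 4 * (S + L' + L + 1) * (4 * L + 8) := by
    nlinarith [mul_nonneg (add_nonneg (add_nonneg hS0 hL') hL) hL]
  have hSL₂ : 0 ≤ 16 * S * L₂ := by positivity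
  have hA32 : 32 + I ≤ A := by linarith
  have hA0 : 0 < A := by linarith
  have hd1 : d ≤ 1 := by nlinarith
  have hΔd' : Δx ≤ d := by rw [hΔd]; nlinarith
  have hsm : 2 * (L₁ + L₂) * d < 1 := by nlinarith
  set a := A * d with ha
  have ha0 : 0 < a := by positivity
  obtain ⟨j, s, hs, hps, hsl⟩ := P.exists_edge hK hL (half_pos ha0)
  set q := initialSlope (v j) with hq
  set ℓ := g j 0 - v j 0 - a / 2 with hℓ
  have hqL := initialSlope_le (P.lipschitz j)
  have hLq := le_initialSlope (P.lipschitz j)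
  have hhq := super_at_initialSlope (P.lipschitz j) (P.continuous_ham j)
    (continuousOn_of_lipschitz (P.source_lipschitz j)) (P.edge j)
  obtain ⟨α, hα, hαl, hα'⟩ := exists_level_left (P.continuous_ham j) hLq
    (by linarith : ℓ < h j q)
  have hαabs : |α| ≤ L := abs_le.mpr ⟨hα.1, hα.2.trans hqL⟩
  have hjump : a < U j 0 - v j 0 := by
    rw [P.grid_glued j i, P.glued j i]
    exact hlt
  -- On `[0, r]` the variations of `U`, `g` and `v` add up to less than `a / 4`, so the inequalities
  -- that hold at `0` with margin `a / 2` persist.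
  set r := a / (4 * (S + L' + L + 1)) with hr
  have hR0 : 0 < 4 * (S + L' + L + 1) := by linarith
  have hrR : r * (4 * (S + L' + L + 1)) = a := by rw [hr]; field_simp
  have hr0 : 0 < r := by positivity
  have hrd : (4 * L + 8) * d ≤ r := by
    rw [hr, le_div_iff₀ hR0]
    calc (4 * L + 8) * d * (4 * (S + L' + L + 1))
        = 4 * (S + L' + L + 1) * (4 * L + 8) * d := by ring
      _ ≤ A * d := by gcongr; linarith
  have hrS : 0 ≤ r * S := by positivity
  have hrL' : 0 ≤ r * L' := by positivity
  have hrL : 0 ≤ r * L := by positivity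
  have hvslope : ∀ t t', 0 ≤ t → t ≤ t' → t' ≤ r → v j t' + α * t' ≤ v j t + α * t := by
    intro t t' ht htt ht'
    rcases hα' with h1 | ⟨h1, h2⟩
    · have h3 := (abs_le.mp (P.lipschitz j t' (ht.trans htt) t ht)).2
      rw [abs_of_nonneg (by linarith)] at h3
      rw [h1]
      linarith
    · refine slope_ge_of_lt_initialSlope (P.lipschitz j) (P.edge j) h1 (fun t ht => ?_) ht htt ht'
      have h3 := (abs_le.mp (P.lipschitz j t ht.1.le 0 le_rfl)).2
      have h4 := (abs_le.mp (P.source_lipschitz j t ht.1.le 0 le_rfl)).1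
      rw [sub_zero, abs_of_pos ht.1] at h3 h4
      have h5 : L * t ≤ L * r := by gcongr; exact ht.2.le
      have h6 : L' * t ≤ L' * r := by gcongr; exact ht.2.le
      rw [h2]
      linarith
  have hlevel : ∀ m : ℕ, m * Δx ≤ r → U j 0 - S * (m * Δx) ≤ U j m →
      ∀ x ∈ Icc α s, a / 4 ≤ U j m + G j x x - g j (m * Δx) := by
    intro m hm hUm x hx
    have hhx : ℓ ≤ h j x := by
      rcases le_total x q with h1 | h1
      · exact hαl x ⟨hx.1, h1⟩
      · exact hsl x ⟨h1, hx.2⟩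
    rcases min_le_iff.mp (P.consistent j x) with h1 | h1
    · have hm0 : 0 ≤ m * Δx := by positivity
      have h4 := (abs_le.mp (P.source_lipschitz j (m * Δx) hm0 0 le_rfl)).2
      rw [sub_zero, abs_of_nonneg hm0] at h4
      have h5 : S * (m * Δx) ≤ S * r := by gcongr
      have h6 : L' * (m * Δx) ≤ L' * r := by gcongr
      linarith
    · linarith [P.truncation j m]
  have hε0 : 0 < ε := lt_of_le_of_lt (by positivity) P.lt_viscosity
  set κ := a / 4 * Δx / (2 * ε) with hκ
  have hκ0 : 0 < κ := by positivity
  have hdisc : ∀ n : ℕ, n * Δx ≤ r → Dplus Δx (U j) (n + 1) ≤ max α (s - n * κ) ∧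
      U j 0 - S * ((n + 1 : ℕ) * Δx) ≤ U j (n + 1) := fun n hn =>
    discrete_slope_le hΔ P.lt_viscosity hL₁ (P.flux_lipschitz j) (P.grid_edge j)
      (hα.2.trans hs.1) hs.2 (by positivity) hlevel hps n hn
  -- After `N` steps the slope bound has fallen by `2 S`, from `s ≤ S` to at most `-S ≤ α`. As `κ`
  -- is of order `d`, this takes a distance at most `2 d`.
  set N := ⌈2 * S / κ⌉₊ with hNdef
  have hNlt : (N : ℝ) < 2 * S / κ + 1 := Nat.ceil_lt_add_one (by positivity)
  have hNge : 2 * S / κ ≤ N := Nat.le_ceil _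
  have hNd : N * Δx ≤ 2 * d := by
    have h1 : N * Δx ≤ (2 * S / κ + 1) * Δx := by gcongr
    have h2 : 2 * S / κ * Δx ≤ d := by
      have e : 2 * S / κ * Δx = 16 * S * ε / a := by
        rw [hκ]
        field_simp
        ring
      rw [e, div_le_iff₀ ha0]
      calc 16 * S * ε ≤ 16 * S * (L₂ * Δx) := by gcongr; exact P.viscosity_le
        _ = 16 * S * L₂ * d ^ 2 := by rw [hΔd]; ring
        _ ≤ A * d ^ 2 := by gcongr; linarith
        _ = d * a := by rw [ha]; ring
    linarith
  have hLd : 0 ≤ L * d := by positivity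
  have hbound := P.le_of_slopes (N := N) (r := r) hd hΔd hαabs hL' hsm (by linarith)
    (fun n hn hnr => by
      refine (hdisc n hnr).1.trans (max_le le_rfl ?_)
      have h1 : 2 * S ≤ n * κ := by
        rw [div_le_iff₀ hκ0] at hNge
        refine hNge.trans ?_
        gcongr
      linarith [hs.2, hα.1])
    hvslope
  have hUN : U j 0 - S * (N * Δx) ≤ U j N := by
    rcases Nat.eq_zero_or_pos N with h0 | h0
    · rw [h0]; simp
    · obtain ⟨n, hn⟩ : ∃ n, N = n + 1 := ⟨N - 1, by omega⟩
      have h1 : n * Δx ≤ r := by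
        have : n * Δx ≤ N * Δx := by gcongr; omega
        linarith
      rw [hn]
      exact (hdisc n h1).2
  have hN0 : 0 ≤ N * Δx := by positivity
  have hvN := (abs_le.mp (P.lipschitz j (N * Δx) hN0 0 le_rfl)).2
  rw [sub_zero, abs_of_nonneg hN0] at hvN
  have h1 : S * (N * Δx) ≤ S * (2 * d) := by gcongr
  have h2 : L * (N * Δx) ≤ L * (2 * d) := by gcongr
  have h3 : (2 * (S + L) + I) * d < A * d := by gcongr; linarith
  linarith

/-- A sub-solution of the scheme exceeds a viscosity super-solution by at most `C √Δx`. -/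
theorem exists_rate (hK : 0 < K) (hL : 0 ≤ L) (hL' : 0 ≤ L') (hL₁ : 0 ≤ L₁) (hL₂ : 0 ≤ L₂)
    (B : ℝ) : ∃ C > 0, ∀ C₀ Δx ε h g v G U, SubSuperPair (K := K) L₁ L₂ L L' B C₀ Δx ε h g v G U →
      ∀ i (m : ℕ), U i m - v i (m * Δx) ≤ C * √Δx := by
  set A := junctionConst K L₁ L₂ L L' with hA
  set I := interiorConst L₁ L₂ L L' with hI
  have hI0 : 2 * (L₁ + L₂) ≤ I := by
    have : 0 ≤ 4 * L * L' + 4 * L ^ 2 := by positivity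
    simp only [hI, interiorConst]
    linarith
  have hA32 : 32 + I ≤ A := by
    have h1 : 0 ≤ 4 * (K * L + L' + L) * (4 * L + 8) + 16 * L := by positivity
    have h2 : 0 ≤ 16 * (K * L) * L₂ := by positivity
    have h3 : 0 ≤ 2 * (K * L + L) := by positivity
    simp only [hA, junctionConst]
    linarith
  have hI00 : 0 ≤ I := by linarith
  have hA0 : 0 < A := by linarith
  refine ⟨A + (I + 8 * L ^ 2) + 2 * |B| * A, by positivity, ?_⟩
  intro C₀ Δx ε h g v G U P i m
  have hd : 0 < √Δx := Real.sqrt_pos.mpr P.mesh_pos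
  have hΔd : Δx = √Δx ^ 2 := (Real.sq_sqrt P.mesh_pos.le).symm
  set d := √Δx
  -- For coarse meshes the uniform bounds alone give the estimate.
  rcases le_or_gt (A * d) 1 with h1 | h1
  · have h2 := P.junction_le hK hd hΔd hL hL' hL₁ hL₂ h1 i
    have h3 := P.le_of_junction_le hd hΔd hL hL' (by positivity) hL₁ hL₂ (by nlinarith) h2 m
    have h4 : 0 ≤ 2 * |B| * A * d := by positivity
    linarith
  · have h2 := (abs_le.mp (P.grid_bound i m)).2
    have h3 := (abs_le.mp (P.bound i (m * Δx) (by have := P.mesh_pos; positivity))).1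
    have h4 : 2 * |B| * 1 ≤ 2 * |B| * (A * d) := by gcongr
    have h5 : 0 ≤ (A + (I + 8 * L ^ 2)) * d := by positivity
    linarith [le_abs_self B]

end Junction

/-! ### From viscosity solutions on the network to the coordinate `t = -x` -/

section Conversion

variable {K : ℕ} {H : Fin K → ℝ → ℝ → ℝ} {h f u : Fin K → ℝ → ℝ}

/-- The test function equal to a quadratic polynomial on the edge `i` and constant on the others. -/
noncomputable def quadTest {K : ℕ} (i : Fin K) (x p k : ℝ) (j : Fin K) (y : ℝ) : ℝ :=
  if j = i then p * (y - x) + k * (y - x) ^ 2 else p * (0 - x) + k * (0 - x) ^ 2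

theorem isTestFunction_quadTest (i : Fin K) (x p k : ℝ) : IsTestFunction (quadTest i x p k) := by
  refine ⟨fun j l => by unfold quadTest; split_ifs <;> rfl, fun j => ?_⟩
  unfold quadTest
  by_cases hj : j = i
  · simp only [hj, if_true]
    fun_prop
  · simp only [hj, if_false]
    fun_prop

theorem edgeSlope_quadTest (i : Fin K) {x : ℝ} (hx : x ≤ 0) (p k : ℝ) :
    edgeSlope (quadTest i x p k) i x = p := by
  have h1 : HasDerivAt (fun y => p * (y - x) + k * (y - x) ^ 2) p x := by
    have h2 := ((hasDerivAt_id x).sub_const x).const_mul p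
    have h3 := (((hasDerivAt_id x).sub_const x).pow 2).const_mul k
    exact (h2.add h3).congr_deriv (by simp)
  have h2 : quadTest i x p k i = fun y => p * (y - x) + k * (y - x) ^ 2 := by
    funext y
    simp [quadTest]
  unfold edgeSlope
  rw [h2]
  exact h1.hasDerivWithinAt.derivWithin (uniqueDiffOn_Iic 0 x hx)

theorem eventually_nhdsWithin_neg {P : ℝ → Prop} (hP : ∀ᶠ t in 𝓝[≥] (0 : ℝ), P t) :
    ∀ᶠ y in 𝓝[≤] (0 : ℝ), P (-y) := by
  have : Tendsto (fun y : ℝ => -y) (𝓝[≤] 0) (𝓝[≥] 0) := by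
    refine tendsto_nhdsWithin_iff.mpr ⟨?_, ?_⟩
    · have := (continuous_neg.tendsto (0 : ℝ)).mono_left (nhdsWithin_le_nhds (s := Iic (0 : ℝ)))
      simpa using this
    · filter_upwards [self_mem_nhdsWithin] with y hy
      exact neg_nonneg.mpr (mem_Iic.mp hy)
  exact this.eventually hP

theorem isTestFunction_linear (s : Fin K → ℝ) : IsTestFunction fun i y => s i * y :=
  ⟨fun i j => by simp, fun i => by fun_prop⟩

theorem edgeSlope_linear (s : Fin K → ℝ) (i : Fin K) :
    edgeSlope (fun i y => s i * y) i 0 = s i := by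
  have h1 : HasDerivAt (fun y => s i * y) (s i) 0 := by
    simpa using (hasDerivAt_id (0 : ℝ)).const_mul (s i)
  exact h1.hasDerivWithinAt.derivWithin (uniqueDiffOn_Iic 0 0 self_mem_Iic)

theorem IsViscositySuper.edgeSuper (hu : IsViscositySuper H u)
    (hSep : ∀ i, ∀ x ≤ (0 : ℝ), ∀ p : ℝ, H i x p = h i p - f i x) (i : Fin K) :
    EdgeSuper (h i) (fun t => f i (-t)) (fun t => u i (-t)) := by
  intro t ht p k hcon
  have hx : -t < 0 := by linarith
  have h1 := hu.edge (quadTest i (-t) p (-k)) (isTestFunction_quadTest _ _ _ _) i (-t) hx (by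
    have h2 : ∀ᶠ y in 𝓝 (-t), u i (-t) - p * (-y - t) - k * (-y - t) ^ 2 ≤ u i (- -y) :=
      (by simpa using (continuous_neg.tendsto (-t)) :
        Tendsto (fun y : ℝ => -y) (𝓝 (-t)) (𝓝 t)).eventually hcon
    refine Filter.Eventually.filter_mono nhdsWithin_le_nhds ?_
    filter_upwards [h2] with y hy
    rw [neg_neg] at hy
    simp only [quadTest, if_true]
    nlinarith)
  rw [edgeSlope_quadTest i hx.le, hSep i _ hx.le] at h1
  simp only
  linarith

/-- Negation turns contact from above into contact from below and reverses slopes. Coercivity is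
lost for the new Hamiltonian, but the comparison needs only its continuity. -/
theorem IsViscositySub.edgeSuper_neg (hu : IsViscositySub H u)
    (hSep : ∀ i, ∀ x ≤ (0 : ℝ), ∀ p : ℝ, H i x p = h i p - f i x) (i : Fin K) :
    EdgeSuper (fun p => -h i (-p)) (fun t => -f i (-t)) (fun t => -u i (-t)) := by
  intro t ht p k hcon
  have hx : -t < 0 := by linarith
  have h1 := hu.edge (quadTest i (-t) (-p) k) (isTestFunction_quadTest _ _ _ _) i (-t) hx (by
    have h2 : ∀ᶠ y in 𝓝 (-t), -u i (-t) - p * (-y - t) - k * (-y - t) ^ 2 ≤ -u i (- -y) :=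
      (by simpa using (continuous_neg.tendsto (-t)) :
        Tendsto (fun y : ℝ => -y) (𝓝 (-t)) (𝓝 t)).eventually hcon
    refine Filter.Eventually.filter_mono nhdsWithin_le_nhds ?_
    filter_upwards [h2] with y hy
    rw [neg_neg] at hy
    simp only [quadTest, if_true]
    nlinarith)
  rw [edgeSlope_quadTest i hx.le, hSep i _ hx.le] at h1
  simp only
  linarith

theorem IsViscositySuper.junctionSuper (hu : IsViscositySuper H u)
    (hSep : ∀ i, ∀ x ≤ (0 : ℝ), ∀ p : ℝ, H i x p = h i p - f i x) :
    JunctionSuper h (fun i t => f i (-t)) (fun i t => u i (-t)) := by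
  intro s hs
  rcases hu.junction _ (isTestFunction_linear s) (fun i => by
    filter_upwards [eventually_nhdsWithin_neg (hs i)] with y hy
    simp only [neg_neg, neg_zero] at hy
    linarith) with h1 | ⟨i, hi⟩
  · left
    simpa only [edgeSlope_linear] using h1
  · right
    refine ⟨i, ?_⟩
    rw [edgeSlope_linear, hSep i 0 le_rfl] at hi
    simp only [neg_zero]
    linarith

theorem IsViscositySub.junctionSuper_neg (hu : IsViscositySub H u)
    (hSep : ∀ i, ∀ x ≤ (0 : ℝ), ∀ p : ℝ, H i x p = h i p - f i x) :
    JunctionSuper (fun i p => -h i (-p)) (fun i t => -f i (-t)) (fun i t => -u i (-t)) := by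
  intro s hs
  rcases hu.junction _ (isTestFunction_linear fun i => -s i) (fun i => by
    filter_upwards [eventually_nhdsWithin_neg (hs i)] with y hy
    simp only [neg_neg, neg_zero] at hy
    linarith) with h1 | ⟨i, hi⟩
  · left
    simp only [edgeSlope_linear, Finset.sum_neg_distrib] at h1
    linarith
  · right
    refine ⟨i, ?_⟩
    rw [edgeSlope_linear, hSep i 0 le_rfl] at hi
    simp only [neg_zero]
    linarith

end Conversion

/-! ### Bounds that depend on the data only -/

section Data

variable {K : ℕ} {H : Fin K → ℝ → ℝ → ℝ} {h f : Fin K → ℝ → ℝ}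

theorem LocallyLipschitzHam.continuous (hLip : LocallyLipschitzHam H)
    (hSep : ∀ i, ∀ x ≤ (0 : ℝ), ∀ p : ℝ, H i x p = h i p - f i x) (i : Fin K) :
    Continuous (h i) := by
  refine continuous_iff_continuousAt.mpr fun p => ?_
  obtain ⟨C, hC⟩ := hLip i (|p| + 1) (by positivity)
  have h1 : ContinuousOn (h i) {q | |q| < |p| + 1} :=
    continuousOn_of_abs_sub_le fun s hs t ht => by
      have := hC 0 le_rfl 0 le_rfl s t hs ht
      rw [hSep i 0 le_rfl, hSep i 0 le_rfl, sub_sub_sub_cancel_right, sub_self, abs_zero,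
        zero_add] at this
      exact this
  exact h1.continuousAt ((isOpen_lt continuous_abs continuous_const).mem_nhds (by simp))

theorem SpaceLipschitzHam.exists_lipschitz (hSpace : SpaceLipschitzHam H)
    (hSep : ∀ i, ∀ x ≤ (0 : ℝ), ∀ p : ℝ, H i x p = h i p - f i x) :
    ∃ L' ≥ 0, ∀ i, ∀ x ≤ (0 : ℝ), ∀ y ≤ (0 : ℝ), |f i x - f i y| ≤ L' * |x - y| := by
  choose C hC0 hC using fun i => hSpace i 1 one_pos
  refine ⟨∑ i, C i, Finset.sum_nonneg fun i _ => (hC0 i).le, fun i x hx y hy => ?_⟩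
  have h1 := hC i x hx y hy 0 (by simp)
  rw [hSep i x hx, hSep i y hy, sub_sub_sub_cancel_left, abs_zero, add_zero, mul_one,
    abs_sub_comm] at h1
  refine h1.trans ?_
  gcongr
  exact Finset.single_le_sum (f := C) (fun i _ => (hC0 i).le) (Finset.mem_univ i)

/-- Bounds and slopes of bounded viscosity solutions are controlled by the data. -/
theorem exists_uniform_bounds (hK : 0 < K) (hLip : LocallyLipschitzHam H) (hCoer : CoerciveHam H)
    (hSep : ∀ i, ∀ x ≤ (0 : ℝ), ∀ p : ℝ, H i x p = h i p - f i x) {F : ℝ}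
    (hF : ∀ i, ∀ x ≤ (0 : ℝ), |f i x| ≤ F) :
    ∃ B L : ℝ, 0 ≤ L ∧ ∀ u : Fin K → ℝ → ℝ, IsViscositySolution H u → BoundedOnNetwork u →
      (∀ i, ∀ t ≥ 0, |u i (-t)| ≤ B) ∧
      ∀ i, ∀ s ≥ 0, ∀ t ≥ 0, |u i (-s) - u i (-t)| ≤ L * |s - t| := by
  have hhb : ∀ i, ∃ A, ∀ p ∈ Icc (-1 : ℝ) 1, ‖h i p‖ ≤ A := fun i =>
    isCompact_Icc.exists_bound_of_continuousOn (hLip.continuous hSep i).continuousOn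
  choose A hA using hhb
  set B := F + ∑ i, |A i| + 1 with hB
  have hA' : ∀ i p, |p| ≤ 1 → |h i p| ≤ ∑ i, |A i| := fun i p hp =>
    ((hA i p (abs_le.mp hp)).trans (le_abs_self _)).trans
      (Finset.single_le_sum (f := fun i => |A i|) (fun i _ => abs_nonneg _) (Finset.mem_univ i))
  -- One `F` pays for passing from `H i 0` to `h i`, the other for the source term in the edge
  -- inequality.
  choose R hR using fun i => hCoer i (B + 2 * F + 1)
  refine ⟨B, ∑ i, |R i|, Finset.sum_nonneg fun i _ => abs_nonneg _, fun u hu hub => ?_⟩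
  obtain ⟨huc, husub, husup⟩ := hu
  obtain ⟨D, hD⟩ := hub
  have hcont : ∀ i, ContinuousOn (fun t => u i (-t)) (Ici 0) := fun i =>
    (huc i).comp continuous_neg.continuousOn fun t ht => neg_nonpos.mpr (mem_Ici.mp ht)
  have hf : ∀ i, ∀ t ≥ 0, |f i (-t)| ≤ F := fun i t ht => hF i _ (neg_nonpos.mpr ht)
  have hlow := lower_bound_of_super hK (v := fun i t => u i (-t)) (A := F + ∑ i, |A i|)
    (fun i j => by simpa using husup.glued i j) hcont
    ⟨D, fun i t ht => hD i _ (neg_nonpos.mpr ht)⟩ (husup.edgeSuper hSep)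
    (husup.junctionSuper hSep) fun i t ht p hp => by
      have h1 := (abs_le.mp (hf i t ht)).1
      have h2 := (abs_le.mp (hA' i p hp)).2
      linarith
  have hup := lower_bound_of_super hK (v := fun i t => -u i (-t)) (A := F + ∑ i, |A i|)
    (fun i j => by simpa using husup.glued i j) (fun i => (hcont i).neg)
    ⟨D, fun i t ht => by rw [abs_neg]; exact hD i _ (neg_nonpos.mpr ht)⟩
    (husub.edgeSuper_neg hSep) (husub.junctionSuper_neg hSep) fun i t ht p hp => by
      have h1 := (abs_le.mp (hf i t ht)).2
      have h2 := (abs_le.mp (hA' i (-p) (by rwa [abs_neg]))).1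
      linarith
  have hbound : ∀ i, ∀ t ≥ 0, |u i (-t)| ≤ B := fun i t ht => by
    have h1 := hlow i t ht
    have h2 := hup i t ht
    rw [abs_le]
    constructor <;> linarith
  refine ⟨hbound, fun i s hs t ht => ?_⟩
  -- Coercivity bounds the contact slopes of sub-solutions, so the Lipschitz estimate is read off
  -- from `-u`.
  have h1 := lipschitz_of_contact_slope_le (w := fun t => -u i (-t)) (R := |R i|) (hcont i).neg
    (fun τ hτ p k hcon => by
      by_contra! hlt
      have h1 := husub.edgeSuper_neg hSep i τ hτ p k hcon
      have h2 := hR i 0 le_rfl (-p) (by rw [abs_neg]; exact (le_abs_self _).trans hlt.le)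
      rw [hSep i 0 le_rfl] at h2
      have h3 := (abs_le.mp (hbound i τ hτ.le)).1
      have h4 := (abs_le.mp (hf i τ hτ.le)).2
      have h5 := (abs_le.mp (hF i 0 le_rfl)).1
      simp only at h1
      linarith) hs ht
  have h2 : |u i (-s) - u i (-t)| = |-u i (-s) - -u i (-t)| := by
    rw [← abs_neg]
    ring_nf
  rw [h2]
  refine h1.trans ?_
  gcongr
  exact Finset.single_le_sum (f := fun i => |R i|) (fun i _ => abs_nonneg _) (Finset.mem_univ i)

theorem schemeOp_neg (Δx ε : ℝ) (G : ℝ → ℝ → ℝ) (U : ℕ → ℝ) (m : ℕ) :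
    schemeOp Δx ε (fun p₁ p₂ => -G (-p₁) (-p₂)) (Dplus Δx (fun m => -U m) m)
      (Dminus Δx (fun m => -U m) m) = -schemeOp Δx ε G (Dplus Δx U m) (Dminus Δx U m) := by
  have h1 : Dplus Δx (fun m => -U m) m = -Dplus Δx U m := by unfold Dplus; ring
  have h2 : Dminus Δx (fun m => -U m) m = -Dminus Δx U m := by unfold Dminus; ring
  rw [h1, h2]
  simp only [schemeOp, neg_neg]
  ring

/-- A constant that bounds the residual of the zero function bounds the bounded solutions of the
scheme. -/
theorem IsSchemeSolution.abs_le {Δx ε L₁ M : ℝ} {G : Fin K → ℝ → ℝ → ℝ} {U : Fin K → ℕ → ℝ}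
    (hU : IsSchemeSolution Δx ε G f U) (hUb : GridBounded U) (hΔ : 0 < Δx) (hL₁ : 0 ≤ L₁)
    (hε : L₁ * Δx ≤ ε)
    (hG : ∀ i, ∀ p₁ p₂ q₁ q₂ : ℝ, |G i p₁ p₂ - G i q₁ q₂| ≤ L₁ * (|p₁ - q₁| + |p₂ - q₂|))
    (hM : ∀ i, ∀ x < (0 : ℝ), |G i 0 0 - f i x| ≤ M) (i : Fin K) (m : ℕ) : |U i m| ≤ M := by
  have hK' : (K : ℝ) ≠ 0 := by exact_mod_cast i.pos.ne'
  have hx : ∀ m : ℕ, m ≠ 0 → -(m * Δx) < 0 := fun m hm => by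
    have : (0 : ℝ) < m := by exact_mod_cast Nat.pos_of_ne_zero hm
    have := mul_pos this hΔ
    linarith
  have havg : ∀ c : ℝ, 1 / (K : ℝ) * ∑ _j : Fin K, c = c := fun c => by
    rw [Finset.sum_const, Finset.card_univ, Fintype.card_fin, nsmul_eq_mul]
    field_simp
  have hop : ∀ (i : Fin K) (c : ℝ) (m : ℕ), schemeOp Δx ε (G i) (Dplus Δx (fun _ => c) m)
      (Dminus Δx (fun _ => c) m) = G i 0 0 := fun i c m => by simp [schemeOp, Dplus, Dminus]
  have hsub : IsSchemeSub Δx ε G f fun _ _ => -M :=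
    ⟨fun _ _ => rfl, fun i m hm => by
      rw [hop]
      linarith [(_root_.abs_le.mp (hM i _ (hx m hm))).2], fun i => (havg _).ge⟩
  have hsup : IsSchemeSuper Δx ε G f fun _ _ => M :=
    ⟨fun _ _ => rfl, fun i m hm => by
      rw [hop]
      linarith [(_root_.abs_le.mp (hM i _ (hx m hm))).1], fun i => (havg _).le⟩
  exact _root_.abs_le.mpr
    ⟨scheme_comparison hΔ hL₁ hε hG hsub hU.isSchemeSuper ⟨|-M|, fun _ _ => le_rfl⟩ hUb i m,
      scheme_comparison hΔ hL₁ hε hG hU.isSchemeSub hsup hUb ⟨|M|, fun _ _ => le_rfl⟩ i m⟩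

end Data

end KirchhoffNetwork

/-! ### Assembly: the comparison applied to both signs. -/

theorem theorem3 {K : ℕ} (hK : 0 < K)
    -- the Hamiltonians `H i x p` and their separated form `h i p - f i x`
    (H : Fin K → ℝ → ℝ → ℝ) (h f : Fin K → ℝ → ℝ)
    (hLip : KirchhoffNetwork.LocallyLipschitzHam H)
    (hCoer : KirchhoffNetwork.CoerciveHam H)
    (hSpace : KirchhoffNetwork.SpaceLipschitzHam H)
    (M : ℝ) (hM : IsLUB {r : ℝ | ∃ i, ∃ x < (0 : ℝ), r = |H i x 0|} M)
    (hSep : ∀ i, ∀ x ≤ (0 : ℝ), ∀ p : ℝ, H i x p = h i p - f i x)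
    -- the numerical Hamiltonians, with a common Lipschitz constant `L₁`
    (G : Fin K → ℝ → ℝ → ℝ) (L₁ : ℝ) (hL₁ : 0 < L₁)
    (hGLip : ∀ i, ∀ p₁ p₂ q₁ q₂ : ℝ,
      |G i p₁ p₂ - G i q₁ q₂| ≤ L₁ * (|p₁ - q₁| + |p₂ - q₂|))
    (hGcons : ∀ i, ∀ p : ℝ,
      G i p p = min (h i p) (M + sSup ((fun x => |f i x|) '' Set.Iio 0) + 1)) :
    -- monotonicity and well-posedness of the scheme
    (∀ Δx ε : ℝ, 0 < Δx → 2 * L₁ * Δx ≤ ε →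
      KirchhoffNetwork.IsMonotoneScheme Δx ε G f ∧
      ∃! U : Fin K → ℕ → ℝ,
        KirchhoffNetwork.IsSchemeSolution Δx ε G f U ∧ KirchhoffNetwork.GridBounded U) ∧
    -- the rate of convergence
    (∀ L₂ > (0 : ℝ), ∃ C > (0 : ℝ), ∀ Δx ε : ℝ, 0 < Δx → 2 * L₁ * Δx ≤ ε → ε ≤ L₂ * Δx →
      ∀ U : Fin K → ℕ → ℝ,
        KirchhoffNetwork.IsSchemeSolution Δx ε G f U → KirchhoffNetwork.GridBounded U →
      ∀ u : Fin K → ℝ → ℝ,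
        KirchhoffNetwork.IsViscositySolution H u → KirchhoffNetwork.BoundedOnNetwork u →
      ∀ i m, |U i m - u i (-(m * Δx))| ≤ C * Δx ^ (1 / 2 : ℝ)) := by
  have hMx : ∀ i, ∀ x < (0 : ℝ), |h i 0 - f i x| ≤ M := fun i x hx => by
    rw [← hSep i x hx.le]
    exact hM.1 ⟨i, x, hx, rfl⟩
  obtain ⟨L', hL', hfL⟩ := hSpace.exists_lipschitz hSep
  set F : Fin K → ℝ := fun i => sSup ((fun x => |f i x|) '' Set.Iio 0) with hFdef
  have hbdd : ∀ i, BddAbove ((fun x => |f i x|) '' Set.Iio 0) := fun i => by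
    refine ⟨M + |h i 0|, ?_⟩
    rintro _ ⟨x, hx, rfl⟩
    have e : f i x = h i 0 - (h i 0 - f i x) := by ring
    simp only
    rw [e]
    exact (abs_sub _ _).trans (by linarith [hMx i x hx])
  have hfF' : ∀ i, ∀ x < (0 : ℝ), |f i x| ≤ F i := fun i x hx =>
    le_csSup (hbdd i) ⟨x, hx, rfl⟩
  have hfF : ∀ i, ∀ x ≤ (0 : ℝ), |f i x| ≤ F i := fun i x hx => by
    rcases hx.lt_or_eq with h1 | rfl
    · exact hfF' i x h1
    -- The supremum is over the open edge; the junction value is reached by Lipschitz continuity.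
    · refine le_of_forall_pos_le_add fun e he => ?_
      have hx : -(e / (L' + 1)) < 0 := by
        have : 0 < e / (L' + 1) := by positivity
        linarith
      have h1 := hfF' i _ hx
      have h2 := hfL i 0 le_rfl _ hx.le
      have h5 : |0 - -(e / (L' + 1))| = e / (L' + 1) := by
        rw [zero_sub, neg_neg, abs_of_pos (by linarith)]
      rw [h5] at h2
      have h3 : L' * (e / (L' + 1)) ≤ e := by
        rw [← mul_div_assoc, div_le_iff₀ (by positivity)]
        nlinarith
      have h4 := abs_sub_abs_le_abs_sub (f i 0) (f i (-(e / (L' + 1))))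
      linarith
  have hF0 : ∀ i, 0 ≤ F i := fun i => (abs_nonneg _).trans (hfF i 0 le_rfl)
  -- The cap is inactive at slope zero, so `M` bounds the residual of the zero function and hence
  -- `U`, uniformly in the mesh.
  have hG0 : ∀ i, G i 0 0 = h i 0 := fun i => by
    rw [hGcons, min_eq_left]
    have h1 := (abs_le.mp (hMx i (-1) (by norm_num))).2
    have h2 := (abs_le.mp (hfF' i (-1) (by norm_num))).2
    change h i 0 ≤ M + F i + 1
    linarith
  have hfsum : ∀ i, ∀ x ≤ (0 : ℝ), |f i x| ≤ ∑ i, F i := fun i x hx =>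
    (hfF i x hx).trans (Finset.single_le_sum (fun i _ => hF0 i) (Finset.mem_univ i))
  have hε₁ : ∀ {Δx ε : ℝ}, 0 < Δx → 2 * L₁ * Δx ≤ ε → L₁ * Δx < ε := fun h1 h2 => by
    have := mul_pos hL₁ h1
    linarith
  refine ⟨fun Δx ε hΔ hε => ⟨KirchhoffNetwork.isMonotoneScheme hΔ (hε₁ hΔ hε).le hGLip, ?_⟩, fun L₂ hL₂ => ?_⟩
  · obtain ⟨U, hU, hUb⟩ := KirchhoffNetwork.exists_scheme_solution hK hΔ hL₁.le (hε₁ hΔ hε).le hGLip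
      (f := f) ⟨∑ i, F i, fun i x hx => hfsum i x hx.le⟩
    refine ⟨U, ⟨hU, hUb⟩, fun V hV => ?_⟩
    funext i m
    exact le_antisymm
      (KirchhoffNetwork.scheme_comparison hΔ hL₁.le (hε₁ hΔ hε).le hGLip hV.1.isSchemeSub hU.isSchemeSuper hV.2 hUb
        i m)
      (KirchhoffNetwork.scheme_comparison hΔ hL₁.le (hε₁ hΔ hε).le hGLip hU.isSchemeSub hV.1.isSchemeSuper hUb hV.2
        i m)
  · obtain ⟨B, L, hL, hBL⟩ := KirchhoffNetwork.exists_uniform_bounds hK hLip hCoer hSep hfsum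
    obtain ⟨C, hC, hrate⟩ := KirchhoffNetwork.exists_rate hK hL hL' hL₁.le hL₂.le (max B M)
    refine ⟨C, hC, fun Δx ε hΔ hε hε₂ U hU hUb u hu hub i m => ?_⟩
    obtain ⟨huB, huL⟩ := hBL u hu hub
    have hUM : ∀ i m, |U i m| ≤ M :=
      hU.abs_le hUb hΔ hL₁.le (hε₁ hΔ hε).le hGLip fun i x hx => by
        rw [hG0]
        exact hMx i x hx
    have hnode : ∀ m : ℕ, -(m * Δx) ≤ 0 := fun m => by
      have : 0 ≤ m * Δx := by positivity
      linarith
    have hupper := hrate (fun i => M + F i + 1) Δx ε h (fun i t => f i (-t)) (fun i t => u i (-t))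
      G U
      { mesh_pos := hΔ
        lt_viscosity := hε₁ hΔ hε
        viscosity_le := hε₂
        continuous_ham := hLip.continuous hSep
        source_lipschitz := fun i s hs t ht => by
          have := hfL i (-s) (by linarith) (-t) (by linarith)
          rwa [neg_sub_neg, abs_sub_comm t s] at this
        flux_lipschitz := hGLip
        consistent := fun i p => (hGcons i p).ge
        truncation := fun i m => by
          have h1 := (abs_le.mp (hUM i m)).1
          have h2 := (abs_le.mp (hfF i _ (hnode m))).2
          linarith
        grid_glued := hU.glued
        grid_bound := fun i m => (hUM i m).trans (le_max_right _ _)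
        grid_edge := fun i m hm => (hU.edge i m hm).le
        grid_junction := fun i => (hU.junction i).le
        glued := fun i j => by simpa using hu.2.1.glued i j
        bound := fun i t ht => (huB i t ht).trans (le_max_left _ _)
        lipschitz := huL
        edge := hu.2.2.edgeSuper hSep
        junction := hu.2.2.junctionSuper hSep } i m
    -- In the negated problem the cap only helps: `G i p p ≤ h i p` becomes the required lower
    -- bound.
    have hlower := hrate (fun i => M + F i + 1) Δx ε (fun i p => -h i (-p))
      (fun i t => -f i (-t)) (fun i t => -u i (-t)) (fun i p₁ p₂ => -G i (-p₁) (-p₂))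
      (fun i m => -U i m)
      { mesh_pos := hΔ
        lt_viscosity := hε₁ hΔ hε
        viscosity_le := hε₂
        continuous_ham := fun i => ((hLip.continuous hSep i).comp continuous_neg).neg
        source_lipschitz := fun i s hs t ht => by
          have := hfL i (-t) (by linarith) (-s) (by linarith)
          rwa [neg_sub_neg] at this ⊢
        flux_lipschitz := fun i p₁ p₂ q₁ q₂ => by
          have := hGLip i (-q₁) (-q₂) (-p₁) (-p₂)
          rw [neg_sub_neg, neg_sub_neg] at this
          rwa [neg_sub_neg]
        consistent := fun i p => by
          refine (min_le_left _ _).trans (neg_le_neg ?_)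
          rw [hGcons]
          exact min_le_left _ _
        truncation := fun i m => by
          have h1 := (abs_le.mp (hUM i m)).2
          have h2 := (abs_le.mp (hfF i _ (hnode m))).1
          linarith
        grid_glued := fun i j => congrArg Neg.neg (hU.glued i j)
        grid_bound := fun i m => by
          rw [abs_neg]
          exact (hUM i m).trans (le_max_right _ _)
        grid_edge := fun i m hm => by
          rw [KirchhoffNetwork.schemeOp_neg]
          linarith [hU.edge i m hm]
        grid_junction := fun i => by
          rw [Finset.sum_neg_distrib, hU.junction i, mul_neg]
        glued := fun i j => by simpa using hu.2.1.glued i j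
        bound := fun i t ht => by
          rw [abs_neg]
          exact (huB i t ht).trans (le_max_left _ _)
        lipschitz := fun i s hs t ht => by
          have := huL i t ht s hs
          rwa [neg_sub_neg, abs_sub_comm s t]
        edge := hu.2.1.edgeSuper_neg hSep
        junction := hu.2.1.junctionSuper_neg hSep } i m
    rw [← Real.sqrt_eq_rpow, abs_le]
    constructor <;> linarith
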